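/- Let $(\mathcal X,\mathcal A)$ be a measurable space, $P$ a transition probability on $\mathcal X$ with invariant probability measure $\nu$, and let $(X_i)_{i\ge 0}$ be a time-homogeneous $\mathcal X$-valued Markov chain with transition probability $P$ and $X_0\sim\nu$. Write $P\varphi(x)=\int\varphi(y)\,P(x,dy)$ and $\nu\varphi=\int\varphi\,d\nu$. Let $(\mathcal B,\|\cdot\|_{\mathcal B})$ be a complex Banach space of measurable functions $\mathcal X\to\mathbb C$ on which $P$ is a bounded linear operator (in particular every $\varphi\in\mathcal B$ is $P(x,\cdot)$-integrable for every $x$), and let $\mathcal B_{\mathbb R}$ be the set of real-valued functions in $\mathcal B$. Let $m\in[1,\infty]$ and $s=m/(m-1)\in[1,\infty]$ (so $\frac1m+\frac1s=1$), and assume: (A) $1_{\mathcal X}\in\mathcal B$; $|\varphi|,\overline{\varphi}\in\mathcal B$ for all $\varphi\in\mathcal B$; and $\varphi\mapsto\varphi(x)$ is continuous on $\mathcal B$ for every $x\in\mathcal X$. (B) There is $K>0$ with $\|\varphi\|_{L^m(\nu)}\le K\|\varphi\|_{\mathcal B}$ for all $\varphi\in\mathcal B$. (C) There are $\kappa>0$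 and $\theta\in[0,1)$ with $\|P^n\varphi-(\nu\varphi)1_{\mathcal X}\|_{\mathcal B}\le\kappa\|\varphi\|_{\mathcal B}\,\theta^n$ for all $\varphi\in\mathcal B$ and $n\ge 0$. Let $k\ge1$, $t_1,\dots,t_k\in[0,1]$, and let $f_1,\dots,f_k:\mathcal X\to\mathbb R$ be measurable with $\nu(f_i^2)<\infty$. Assume also, with $\mathcal C=\mathrm{Vect}_{\mathbb R}(f_1,\dots,f_k)$ the real linear span: (D) For every $f\in\mathcal C$ and all $t$ in a neighbourhood of $0$ in $\mathbb R$, $P_{f,t}\varphi:=P(e^{itf}\varphi)$ defines a bounded linear operator on $\mathcal B$; the map $t\mapsto P_{f,t}$ is twice continuously differentiable in operator norm on this neighbourhood; and for $k'=0,1,2$ its $k'$-th derivative at $t=0$ is the operator $\varphi\mapsto P((if)^{k'}\varphi)$, the integrals defining it being absolutely convergent. For $g:\mathcal X\to\mathbb R$ put $S_n(g,t)=\sum_{i=1}^{\lfloor nt\rfloor}g(X_i)$. Then there is a symmetric positive semidefinite matrix $\Sigma\in\mathbb R^{k\times k}$ such that, as $n\to\infty$, $$\frac1{\sqrt n}\bigl(S_n(f_1-\nu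 f_1,t_1),\dots,S_n(f_k-\nu f_k,t_k)\bigr)\longrightarrow N(0,\Sigma)\quad\text{in distribution},$$ where $N(0,\Sigma)$ is the (possibly degenerate) centred normal law on $\mathbb R^k$ with covariance matrix $\Sigma$. If moreover $f_1,\dots,f_k\in L^s(\nu)\cap\mathcal B_{\mathbb R}$, then for all $i,j$ the following series converge absolutely and $$\Sigma_{i,j}=\min\{t_i,t_j\}\Bigl\{\sum_{l=0}^\infty\mathrm{Cov}\bigl(f_i(X_0),f_j(X_l)\bigr)+\sum_{l=1}^\infty\mathrm{Cov}\bigl(f_j(X_0),f_i(X_l)\bigr)\Bigr\}.$$ -/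

import Mathlib

open MeasureTheory ProbabilityTheory Filter Topology
open scoped ENNReal

noncomputable section

namespace SpectralGapCLT

variable {𝒳 : Type*} [MeasurableSpace 𝒳]
variable {𝓑 : Type*} [NormedAddCommGroup 𝓑] [NormedSpace ℂ 𝓑]

/-- The Markov operator `P u (x) = ∫ u(y) P(x, dy)` on complex functions. -/
def markovOp (P : Kernel 𝒳 𝒳) (u : 𝒳 → ℂ) : 𝒳 → ℂ :=
  fun x => ∫ y, u y ∂(P x)

/-- The Banach space `𝓑` is a space of measurable complex functions on `𝒳`: its elements are
identified, through the injective linear map `ι`, with measurable functions `𝒳 → ℂ`. -/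
structure IsFunctionSpace (ι : 𝓑 →ₗ[ℂ] (𝒳 → ℂ)) : Prop where
  injective : Function.Injective ι
  measurable : ∀ φ, Measurable (ι φ)

/-- The bounded operator `T` on `𝓑` is the operator `φ ↦ P (w φ)`, i.e. for every `φ ∈ 𝓑` and
`x ∈ 𝒳` the integral `∫ w(y) φ(y) P(x, dy)` exists and equals `(T φ)(x)`. -/
def Represents (ι : 𝓑 →ₗ[ℂ] (𝒳 → ℂ)) (P : Kernel 𝒳 𝒳) (w : 𝒳 → ℂ) (T : 𝓑 →L[ℂ] 𝓑) : Prop :=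
  ∀ φ : 𝓑, (∀ x, Integrable (fun y => w y * ι φ y) (P x)) ∧
    ι (T φ) = markovOp P (fun y => w y * ι φ y)

/-- `P` is a bounded linear operator on `𝓑`. -/
def ActsBoundedly (ι : 𝓑 →ₗ[ℂ] (𝒳 → ℂ)) (P : Kernel 𝒳 𝒳) : Prop :=
  ∃ T : 𝓑 →L[ℂ] 𝓑, Represents ι P (fun _ => 1) T

/-- Condition (A): `1 ∈ 𝓑`; `|φ|` and `conj φ` are in `𝓑` for `φ ∈ 𝓑`; point evaluations
(Dirac measures) are continuous on `𝓑`. -/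
structure CondA (ι : 𝓑 →ₗ[ℂ] (𝒳 → ℂ)) : Prop where
  one_mem : (fun _ => (1 : ℂ)) ∈ LinearMap.range ι
  abs_mem : ∀ φ : 𝓑, (fun x => ((‖ι φ x‖ : ℝ) : ℂ)) ∈ LinearMap.range ι
  conj_mem : ∀ φ : 𝓑, (fun x => (starRingEnd ℂ) (ι φ x)) ∈ LinearMap.range ι
  continuous_eval : ∀ x, Continuous (fun φ : 𝓑 => ι φ x)

/-- Condition (B): `𝓑` is continuously included in `L^m(ν)`. -/
def CondB (ι : 𝓑 →ₗ[ℂ] (𝒳 → ℂ)) (ν : Measure 𝒳) (m : ℝ≥0∞) : Prop :=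
  ∃ K : ℝ, 0 < K ∧ ∀ φ : 𝓑, eLpNorm (ι φ) m ν ≤ ENNReal.ofReal (K * ‖φ‖)

/-- Condition (C): `‖Pⁿ φ - (ν φ) 1‖ ≤ κ ‖φ‖ θⁿ` in `𝓑`, for all `φ ∈ 𝓑` and all `n`. The element
`ψ` is the function `Pⁿ φ - (ν φ) 1`, seen in `𝓑`. -/
def CondC (ι : 𝓑 →ₗ[ℂ] (𝒳 → ℂ)) (P : Kernel 𝒳 𝒳) (ν : Measure 𝒳) : Prop :=
  ∃ κ θ : ℝ, 0 < κ ∧ 0 ≤ θ ∧ θ < 1 ∧ ∀ (n : ℕ) (φ : 𝓑), ∃ ψ : 𝓑,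
    ι ψ = (fun x => (markovOp P)^[n] (ι φ) x - ∫ y, ι φ y ∂ν) ∧ ‖ψ‖ ≤ κ * ‖φ‖ * θ ^ n

/-- Condition (D) for a real vector space `C` of functions: for every `f ∈ C`, for `t` in a
neighbourhood of `0`, the operator `P_{f,t} φ = P (exp (i t f) φ)` is bounded on `𝓑`, the map
`t ↦ P_{f,t}` is of class `C²` there for the operator norm, and its derivatives of order `k ≤ 2`
at `t = 0` are `φ ↦ P ((i f)^k φ)`. -/
def CondD (ι : 𝓑 →ₗ[ℂ] (𝒳 → ℂ)) (P : Kernel 𝒳 𝒳) (C : Submodule ℝ (𝒳 → ℝ)) : Prop :=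
  ∀ f ∈ C, ∃ (ε : ℝ) (Q : ℝ → (𝓑 →L[ℂ] 𝓑)), 0 < ε ∧
    (∀ t ∈ Set.Ioo (-ε) ε,
      Represents ι P (fun y => Complex.exp (Complex.I * (t : ℂ) * (f y : ℂ))) (Q t)) ∧
    ContDiffOn ℝ 2 Q (Set.Ioo (-ε) ε) ∧
    ∀ k : ℕ, k ≤ 2 →
      Represents ι P (fun y => (Complex.I * (f y : ℂ)) ^ k) (iteratedDeriv k Q 0)

/-- `X` is a time homogeneous Markov chain with transition probability `P` and initial
distribution `ν`: `X 0` has law `ν`, and the conditional probability of `X (n+1) ∈ A`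
given `X 0, …, X n` is `P (X n, A)`. -/
structure IsMarkovChain {Ω : Type*} [MeasurableSpace Ω] (μ : Measure Ω)
    (P : Kernel 𝒳 𝒳) (ν : Measure 𝒳) (X : ℕ → Ω → 𝒳) : Prop where
  measurable : ∀ n, Measurable (X n)
  initial : μ.map (X 0) = ν
  markov : ∀ (n : ℕ) (A : Set 𝒳), MeasurableSet A →
    μ[(X (n + 1) ⁻¹' A).indicator (fun _ => (1 : ℝ)) |
        ⨆ j ∈ Set.Iic n, MeasurableSpace.comap (X j) inferInstance]
      =ᵐ[μ] fun ω => (P (X n ω)).real A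

/-- The partial sums `S_n(g, t) = ∑_{j=1}^{[nt]} g(X_j)`. -/
def partialSum {Ω : Type*} (X : ℕ → Ω → 𝒳) (n : ℕ) (g : 𝒳 → ℝ) (t : ℝ) (ω : Ω) : ℝ :=
  ∑ j ∈ Finset.Icc 1 ⌊(n : ℝ) * t⌋₊, g (X j ω)

end SpectralGapCLT

end

namespace SpectralGapCLT

open Asymptotics

/-! ### The Markov property and stationarity of the chain -/

section Chain

/-! This is the Nagaev–Guivarc'h method, with approximate eigenvectors in place of perturbed
eigenvalues. For `f` in the span, with mean `c`, a vector `V t = 1 + i t h + t² v` is sought such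
that the twisted operator `P (e^{itf} ·)` maps it to `e^{itc - a t²/2} V t` up to `o(t²)`. Matching
orders 1 and 2 gives two Poisson equations. They are solved by the geometric series that the
spectral gap provides. The second is solvable only if its right side has mean zero, and this fixes
`a` (`approx_eigenvector`, `SpectralGap.exists_approx_eigen`).

At scale `t = n^{-1/2}`, conditioning backwards along the chain costs `o(1/n)` at each of `n` steps,
hence `o(1)` in all (`IsMarkovChain.norm_integral_expSum_sub_le`). Different horizons `t_j` mean
that at time `l` only the indices with `l ≤ ⌊n t_j⌋` contribute. This active set changes at most `k`
times, and each change replaces one `V` by another, both within `O(n^{-1/2})` of `1`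
(`sum_change_le`). The accumulated exponents produce the factors `min (t i) (t j)`
(`sum_active_active`).

The characteristic functions therefore converge to the exponential of a quadratic form, and Lévy's
continuity theorem concludes. The form is nonnegative because characteristic functions are bounded
by 1. When the `f_i` lie in `L^s` and in `𝓑`, pairing with the Poisson series term by term gives the
covariance series (`IsMarkovChain.hasSum_covariance`). -/

lemma integrable_integral_of_compProd {α β : Type*} [MeasurableSpace α] [MeasurableSpace β]
    {μ : Measure α} [SFinite μ] {κ : Kernel α β} [IsSFiniteKernel κ] {f : α × β → ℂ}
    (hf : Integrable f (μ ⊗ₘ κ)) : Integrable (fun a => ∫ b, f (a, b) ∂(κ a)) μ := by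
  simpa using MeasureTheory.Integrable.integral_compProd (by exact hf : Integrable f ((Kernel.const Unit μ ⊗ₖ Kernel.prodMkLeft Unit κ) ()))

variable {𝒳 Ω : Type*} [MeasurableSpace 𝒳] [mΩ : MeasurableSpace Ω]
  {μ : Measure Ω} [IsProbabilityMeasure μ] {P : Kernel 𝒳 𝒳} [IsMarkovKernel P]
  {ν : Measure 𝒳} [IsProbabilityMeasure ν] {X : ℕ → Ω → 𝒳}

/-- The `σ`-algebra generated by the chain up to time `n`. -/
abbrev past (X : ℕ → Ω → 𝒳) (n : ℕ) : MeasurableSpace Ω :=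
  ⨆ j ∈ Set.Iic n, MeasurableSpace.comap (X j) inferInstance

lemma past_le (hX : ∀ n, Measurable (X n)) (n : ℕ) : past X n ≤ mΩ :=
  iSup₂_le fun j _ => (hX j).comap_le

omit mΩ in
lemma measurable_past (X : ℕ → Ω → 𝒳) {j n : ℕ} (hj : j ≤ n) : Measurable[past X n] (X j) :=
  (comap_measurable (X j)).mono
    (le_iSup₂_of_le (f := fun j (_ : j ∈ Set.Iic n) => MeasurableSpace.comap (X j) inferInstance)
      j hj le_rfl) le_rfl

omit [IsProbabilityMeasure ν] in
-- Both sides are probability measures, so boxes suffice. On a box the identity is the defining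
-- property of conditional expectation over a past event. The free variable `Y` later carries the
-- exponential of the sum up to time `n`.
lemma IsMarkovChain.map_prod_succ (hX : IsMarkovChain μ P ν X) {E : Type*} [MeasurableSpace E]
    (n : ℕ) {Y : Ω → E} (hY : Measurable[past X n] Y) :
    μ.map (fun ω => ((Y ω, X n ω), X (n + 1) ω)) =
      (μ.map fun ω => (Y ω, X n ω)) ⊗ₘ Kernel.prodMkLeft E P := by
  have hle := past_le hX.measurable n
  have hYm : Measurable Y := hY.mono hle le_rfl
  have h0 := hX.measurable n
  have h1 := hX.measurable (n + 1)
  have hpair : Measurable fun ω => (Y ω, X n ω) := hYm.prodMk h0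
  have htrip : Measurable fun ω => ((Y ω, X n ω), X (n + 1) ω) := hpair.prodMk h1
  have := Measure.isProbabilityMeasure_map (μ := μ) htrip.aemeasurable
  have := Measure.isProbabilityMeasure_map (μ := μ) hpair.aemeasurable
  rw [Measure.ext_prod₃_iff']
  intro B D A hB hD hA
  have hs : MeasurableSet[past X n] (Y ⁻¹' B ∩ X n ⁻¹' D) :=
    (hY hB).inter (measurable_past X le_rfl hD)
  rw [Measure.map_apply htrip ((hB.prod hD).prod hA),
    Measure.compProd_apply_prod (hB.prod hD) hA,
    setLIntegral_map (hB.prod hD)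
      ((Kernel.prodMkLeft E P).measurable_coe hA) hpair]
  have key : ∫ ω in Y ⁻¹' B ∩ X n ⁻¹' D, (P (X n ω)).real A ∂μ =
      μ.real ((Y ⁻¹' B ∩ X n ⁻¹' D) ∩ X (n + 1) ⁻¹' A) := by
    rw [← setIntegral_congr_ae (hle _ hs) ((hX.markov n A hA).mono fun ω h _ => h),
      setIntegral_condExp hle ((integrable_const _).indicator (h1 hA)) hs,
      setIntegral_indicator (h1 hA)]
    simp
  have hint : Integrable (fun ω => (P (X n ω)).real A) (μ.restrict (Y ⁻¹' B ∩ X n ⁻¹' D)) := by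
    refine Integrable.of_bound (C := 1) ?_ (ae_of_all _ fun ω => ?_)
    · exact ((P.measurable_coe hA).comp h0).ennreal_toReal.aestronglyMeasurable
    · rw [Real.norm_of_nonneg measureReal_nonneg]; exact measureReal_le_one
  have h2 : (fun ω => (Kernel.prodMkLeft E P) (Y ω, X n ω) A) =
      fun ω => ENNReal.ofReal ((P (X n ω)).real A) := by
    funext ω
    rw [Kernel.prodMkLeft_apply, ofReal_measureReal]
  have h3 : (fun ω => (Y ω, X n ω)) ⁻¹' B ×ˢ D = Y ⁻¹' B ∩ X n ⁻¹' D := rfl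
  rw [h2, h3, ← ofReal_integral_eq_lintegral_ofReal hint (ae_of_all _ fun _ => measureReal_nonneg),
    key, ofReal_measureReal]
  rfl

omit [IsProbabilityMeasure ν] in
lemma IsMarkovChain.map_eq (hX : IsMarkovChain μ P ν X) (hν : Kernel.Invariant P ν) (n : ℕ) :
    μ.map (X n) = ν := by
  induction n with
  | zero => exact hX.initial
  | succ n ih =>
    -- A trivial `Y` leaves only the law of two consecutive states.
    have h := hX.map_prod_succ (E := Unit) n (Y := fun _ => ()) measurable_const
    have h1 := hX.measurable (n + 1)
    have h0 := hX.measurable n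
    have h' := congrArg (fun m => m.map Prod.snd) h
    rw [Measure.map_map measurable_snd (by fun_prop)] at h'
    have e : (Prod.snd ∘ fun ω => (((), X n ω), X (n + 1) ω)) = X (n + 1) := rfl
    rw [e] at h'
    rw [h', ← Measure.snd, Measure.snd_compProd]
    ext A hA
    rw [Measure.bind_apply hA (Kernel.aemeasurable _),
      lintegral_map ((Kernel.prodMkLeft Unit P).measurable_coe hA) (by fun_prop)]
    simp only [Kernel.prodMkLeft_apply]
    rw [← lintegral_map (f := fun x => P x A) (P.measurable_coe hA) h0, ih,
      ← Measure.bind_apply hA (Kernel.aemeasurable _), hν]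

omit [IsProbabilityMeasure ν] in
lemma IsMarkovChain.integrable_comp (hX : IsMarkovChain μ P ν X) (hν : Kernel.Invariant P ν)
    (n : ℕ) {φ : 𝒳 → ℂ} (hφ : Integrable φ ν) : Integrable (fun ω => φ (X n ω)) μ := by
  rw [← hX.map_eq hν n] at hφ
  exact hφ.comp_measurable (hX.measurable n)

omit [IsProbabilityMeasure ν] in
/-- Markov property in expectation. -/
lemma IsMarkovChain.integral_mul_succ (hX : IsMarkovChain μ P ν X) (n : ℕ) {F : Ω → ℂ}
    (hF : Measurable[past X n] F) {φ : 𝒳 → ℂ} (hφ : Measurable φ)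
    (hint : Integrable (fun ω => F ω * φ (X (n + 1) ω)) μ) :
    Integrable (fun ω => F ω * markovOp P φ (X n ω)) μ ∧
    ∫ ω, F ω * φ (X (n + 1) ω) ∂μ = ∫ ω, F ω * markovOp P φ (X n ω) ∂μ := by
  have hle := past_le hX.measurable n
  have hFm : Measurable F := hF.mono hle le_rfl
  have h0 := hX.measurable n
  have h1 := hX.measurable (n + 1)
  have hpair : Measurable fun ω => (F ω, X n ω) := hFm.prodMk h0
  have htrip : Measurable fun ω => ((F ω, X n ω), X (n + 1) ω) := hpair.prodMk h1
  have := Measure.isProbabilityMeasure_map (μ := μ) hpair.aemeasurable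
  have law := hX.map_prod_succ n hF
  have hg : Measurable fun p : (ℂ × 𝒳) × 𝒳 => p.1.1 * φ p.2 := by fun_prop
  have hint' : Integrable (fun p : (ℂ × 𝒳) × 𝒳 => p.1.1 * φ p.2)
      ((μ.map fun ω => (F ω, X n ω)) ⊗ₘ Kernel.prodMkLeft ℂ P) := by
    rw [← law, integrable_map_measure hg.aestronglyMeasurable htrip.aemeasurable]
    exact hint
  have hi := integrable_integral_of_compProd hint'
  have hsm : AEStronglyMeasurable (fun p : ℂ × 𝒳 => p.1 * markovOp P φ p.2)
      (μ.map fun ω => (F ω, X n ω)) := by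
    have hm : Measurable (markovOp P φ) := hφ.stronglyMeasurable.integral_kernel.measurable
    exact (measurable_fst.mul (hm.comp measurable_snd)).aestronglyMeasurable
  have hmul : (fun p : ℂ × 𝒳 => ∫ y, p.1 * φ y ∂(Kernel.prodMkLeft ℂ P p)) =
      fun p => p.1 * markovOp P φ p.2 := by
    funext p
    rw [integral_const_mul, Kernel.prodMkLeft_apply]; rfl
  rw [hmul] at hi
  constructor
  · exact (integrable_map_measure hsm hpair.aemeasurable).1 hi
  · have e1 : ∫ ω, F ω * φ (X (n + 1) ω) ∂μ =
        ∫ p, p.1.1 * φ p.2 ∂(μ.map fun ω => ((F ω, X n ω), X (n + 1) ω)) := by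
      rw [integral_map htrip.aemeasurable hg.aestronglyMeasurable]
    rw [e1, law, Measure.integral_compProd hint', hmul,
      integral_map hpair.aemeasurable hsm]

lemma integral_markovOp (hν : Kernel.Invariant P ν) {φ : 𝒳 → ℂ}
    (hφ : Integrable φ ν) :
    Integrable (markovOp P φ) ν ∧ ∫ x, markovOp P φ x ∂ν = ∫ x, φ x ∂ν := by
  have h : Integrable φ (P ∘ₘ ν) := by rw [hν.def]; exact hφ
  have h2 := (Measure.integrable_compProd_snd_iff h.1).2 h
  refine ⟨integrable_integral_of_compProd h2, ?_⟩
  have h3 := Measure.integral_compProd h2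
  have h4 : ∫ p, φ p.2 ∂(ν ⊗ₘ P) = ∫ x, φ x ∂((ν ⊗ₘ P).map Prod.snd) :=
    (integral_map measurable_snd.aemeasurable
      (by rw [← Measure.snd, Measure.snd_compProd]; exact h.1)).symm
  rw [h4, ← Measure.snd, Measure.snd_compProd, hν.def] at h3
  exact h3.symm

end Chain

/-! ### Characteristic functions along the chain -/

section Product

variable {𝒳 Ω : Type*} [MeasurableSpace 𝒳] [mΩ : MeasurableSpace Ω]
  {μ : Measure Ω} [IsProbabilityMeasure μ] {P : Kernel 𝒳 𝒳} [IsMarkovKernel P]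
  {ν : Measure 𝒳} {X : ℕ → Ω → 𝒳}

omit [IsMarkovKernel P] in
lemma measurable_markovOp {φ : 𝒳 → ℂ} (hφ : Measurable φ) : Measurable (markovOp P φ) :=
  hφ.stronglyMeasurable.integral_kernel.measurable

/-- Each use of the Markov property lowers the time by one and replaces `b` by `P b`, so the
induction must keep `b` general. -/
lemma IsMarkovChain.integral_mul_iterate (hX : IsMarkovChain μ P ν X) {a : 𝒳 → ℂ}
    (ha : Measurable a) (l : ℕ) {b : 𝒳 → ℂ} (hb : Measurable b)
    (hint : Integrable (fun ω => a (X 0 ω) * b (X l ω)) μ) :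
    ∫ ω, a (X 0 ω) * b (X l ω) ∂μ = ∫ x, a x * (markovOp P)^[l] b x ∂ν := by
  induction l generalizing b with
  | zero =>
    rw [← hX.initial, integral_map (hX.measurable 0).aemeasurable]
    · rfl
    · exact (ha.mul hb).aestronglyMeasurable
  | succ l ih =>
    have h := hX.integral_mul_succ l (F := fun ω => a (X 0 ω))
      (ha.comp (measurable_past X (Nat.zero_le l))) hb hint
    rw [h.2, ih (measurable_markovOp hb) h.1, Function.iterate_succ]
    rfl

/-- The unimodular variable `exp (i ∑_{1 ≤ j ≤ l} w_j (X_j))`. -/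
noncomputable def expSum (X : ℕ → Ω → 𝒳) (w : ℕ → 𝒳 → ℝ) (l : ℕ) (ω : Ω) : ℂ :=
  Complex.exp (((∑ j ∈ Finset.range l, w (j + 1) (X (j + 1) ω) : ℝ) : ℂ) * Complex.I)

omit [MeasurableSpace 𝒳] mΩ in
lemma norm_expSum (X : ℕ → Ω → 𝒳) (w : ℕ → 𝒳 → ℝ) (l : ℕ) (ω : Ω) : ‖expSum X w l ω‖ = 1 :=
  Complex.norm_exp_ofReal_mul_I _

omit [MeasurableSpace 𝒳] mΩ in
lemma expSum_succ (X : ℕ → Ω → 𝒳) (w : ℕ → 𝒳 → ℝ) (l : ℕ) (ω : Ω) :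
    expSum X w (l + 1) ω =
      expSum X w l ω * Complex.exp (Complex.I * (w (l + 1) (X (l + 1) ω) : ℂ)) := by
  unfold expSum
  rw [← Complex.exp_add, Finset.sum_range_succ]
  congr 1
  push_cast
  ring

omit mΩ in
lemma measurable_expSum {w : ℕ → 𝒳 → ℝ} (hw : ∀ l, Measurable (w l)) (l : ℕ) :
    Measurable[past X l] (expSum X w l) := by
  have h : Measurable[past X l] fun ω => ∑ j ∈ Finset.range l, w (j + 1) (X (j + 1) ω) :=
    Finset.measurable_sum _ fun j hj => (hw (j + 1)).comp
      (measurable_past X (Finset.mem_range.1 hj))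
  exact Complex.measurable_exp.comp ((Complex.measurable_ofReal.comp h).mul_const _)

lemma IsMarkovChain.integrable_expSum_mul (hX : IsMarkovChain μ P ν X)
    (hν : Kernel.Invariant P ν) {w : ℕ → 𝒳 → ℝ} (hw : ∀ l, Measurable (w l)) (l n : ℕ)
    {φ : 𝒳 → ℂ} (hφ : Integrable φ ν) :
    Integrable (fun ω => expSum X w l ω * φ (X n ω)) μ :=
  (hX.integrable_comp hν n hφ).bdd_mul (c := 1)
    ((measurable_expSum hw l).mono (past_le hX.measurable l) le_rfl).aestronglyMeasurable
    (ae_of_all _ fun ω => (norm_expSum X w l ω).le)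

lemma IsMarkovChain.norm_integral_expSum_mul_le (hX : IsMarkovChain μ P ν X)
    (hν : Kernel.Invariant P ν) (w : ℕ → 𝒳 → ℝ) (l n : ℕ) {φ : 𝒳 → ℂ} (hφ : Integrable φ ν) :
    ‖∫ ω, expSum X w l ω * φ (X n ω) ∂μ‖ ≤ ∫ x, ‖φ x‖ ∂ν := by
  refine (norm_integral_le_integral_norm _).trans ?_
  simp_rw [norm_mul, norm_expSum, one_mul]
  have h := hφ.norm.aestronglyMeasurable
  rw [← hX.map_eq hν n] at h
  rw [← integral_map (hX.measurable n).aemeasurable h, hX.map_eq hν n]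

/-- Characteristic functions of sums along the chain, from functions `V l` that are approximate
eigenfunctions of the twisted operators `φ ↦ P (exp (i w_l) φ)`. -/
lemma IsMarkovChain.norm_integral_expSum_sub_le (hX : IsMarkovChain μ P ν X)
    [IsProbabilityMeasure ν] (hν : Kernel.Invariant P ν) {w : ℕ → 𝒳 → ℝ}
    (hw : ∀ l, Measurable (w l)) {V r : ℕ → 𝒳 → ℂ} {s : ℕ → ℝ} (hVm : ∀ l, Measurable (V l))
    (hV : ∀ l, Integrable (V l) ν) (hr : ∀ l, Integrable (r l) ν)
    (heig : ∀ l x, markovOp P (fun y => Complex.exp (Complex.I * (w l y : ℂ)) * V l y) x =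
      Complex.exp (-(s l : ℂ)) * V l x + r l x) (N : ℕ) :
    ‖∫ ω, expSum X w N ω ∂μ - Complex.exp (-((∑ j ∈ Finset.range N, s (j + 1) : ℝ) : ℂ))‖ ≤
      Real.exp (∑ j ∈ Finset.range N, |s (j + 1)|) * (∫ x, ‖V 0 x - 1‖ ∂ν +
        ∑ j ∈ Finset.range N, (∫ x, ‖r (j + 1) x‖ ∂ν + ∫ x, ‖V (j + 1) x - V j x‖ ∂ν)) +
        ∫ x, ‖V N x - 1‖ ∂ν := by
  -- Conditioning on the past up to `l` applies the twisted operator to `V (l + 1)`. The result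
  -- still involves `V (l + 1)` at time `l`; exchanging it for `V l` gives the middle term.
  have hstep (l : ℕ) : ∫ ω, expSum X w (l + 1) ω * V (l + 1) (X (l + 1) ω) ∂μ =
      Complex.exp (-(s (l + 1) : ℂ)) * ∫ ω, expSum X w l ω * V l (X l ω) ∂μ +
      Complex.exp (-(s (l + 1) : ℂ)) *
        ∫ ω, expSum X w l ω * (V (l + 1) (X l ω) - V l (X l ω)) ∂μ +
      ∫ ω, expSum X w l ω * r (l + 1) (X l ω) ∂μ := by
    have hm : Measurable fun y => Complex.exp (Complex.I * (w (l + 1) y : ℂ)) * V (l + 1) y :=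
      (Complex.measurable_exp.comp
        ((Complex.measurable_ofReal.comp (hw (l + 1))).const_mul _)).mul (hVm _)
    have h1 := hX.integrable_expSum_mul hν hw (l + 1) (l + 1) (hV (l + 1))
    simp_rw [expSum_succ, mul_assoc] at h1 ⊢
    rw [(hX.integral_mul_succ l (measurable_expSum hw l) hm h1).2, ← integral_const_mul,
      ← integral_const_mul, ← integral_add, ← integral_add]
    · refine integral_congr_ae (ae_of_all _ fun ω => ?_)
      simp only [heig]
      ring
    · exact ((hX.integrable_expSum_mul hν hw l l (hV l)).const_mul _).add
        ((hX.integrable_expSum_mul hν hw l l ((hV (l + 1)).sub (hV l))).const_mul _)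
    · exact hX.integrable_expSum_mul hν hw l l (hr (l + 1))
    · exact (hX.integrable_expSum_mul hν hw l l (hV l)).const_mul _
    · exact (hX.integrable_expSum_mul hν hw l l ((hV (l + 1)).sub (hV l))).const_mul _
  have hnorm (a : ℝ) : ‖Complex.exp (-(a : ℂ))‖ ≤ Real.exp |a| := by
    rw [Complex.norm_exp]
    simpa using neg_le_abs a
  have hmain (l : ℕ) : ‖∫ ω, expSum X w l ω * V l (X l ω) ∂μ -
      Complex.exp (-((∑ j ∈ Finset.range l, s (j + 1) : ℝ) : ℂ))‖ ≤
      Real.exp (∑ j ∈ Finset.range l, |s (j + 1)|) * (∫ x, ‖V 0 x - 1‖ ∂ν +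
        ∑ j ∈ Finset.range l, (∫ x, ‖r (j + 1) x‖ ∂ν + ∫ x, ‖V (j + 1) x - V j x‖ ∂ν)) := by
    induction l with
    | zero =>
      have h := hX.norm_integral_expSum_mul_le hν w 0 0 ((hV 0).sub (integrable_const (1 : ℂ)))
      have h0 : ∀ ω, expSum X w 0 ω = 1 := fun ω => by simp [expSum]
      simp only [h0, one_mul, Pi.sub_apply] at h
      rw [integral_sub (hX.integrable_comp hν 0 (hV 0)) (integrable_const _)] at h
      simpa [h0] using h
    | succ l ih =>
      have e1 := hX.norm_integral_expSum_mul_le hν w l l ((hV (l + 1)).sub (hV l))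
      have e2 := hX.norm_integral_expSum_mul_le hν w l l (hr (l + 1))
      have e3 := hnorm (s (l + 1))
      simp only [Pi.sub_apply] at e1
      rw [hstep, Finset.sum_range_succ (fun j => s (j + 1)),
        Finset.sum_range_succ (fun j => |s (j + 1)|), Finset.sum_range_succ, Complex.ofReal_add,
        neg_add, Complex.exp_add, Real.exp_add]
      set A := ∫ ω, expSum X w l ω * V l (X l ω) ∂μ
      set B := ∫ ω, expSum X w l ω * (V (l + 1) (X l ω) - V l (X l ω)) ∂μ
      set C := ∫ ω, expSum X w l ω * r (l + 1) (X l ω) ∂μ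
      set L := Complex.exp (-(s (l + 1) : ℂ))
      set Λ := Complex.exp (-((∑ j ∈ Finset.range l, s (j + 1) : ℝ) : ℂ))
      set S := Real.exp (∑ j ∈ Finset.range l, |s (j + 1)|)
      set T := Real.exp |s (l + 1)|
      set D := ∫ x, ‖V 0 x - 1‖ ∂ν + ∑ j ∈ Finset.range l,
        (∫ x, ‖r (j + 1) x‖ ∂ν + ∫ x, ‖V (j + 1) x - V j x‖ ∂ν)
      set b := ∫ x, ‖V (l + 1) x - V l x‖ ∂ν
      set c := ∫ x, ‖r (l + 1) x‖ ∂ν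
      have hT : 1 ≤ T := Real.one_le_exp (abs_nonneg _)
      have hS : 1 ≤ S := Real.one_le_exp (Finset.sum_nonneg fun _ _ => abs_nonneg _)
      have hb : 0 ≤ b := integral_nonneg fun _ => norm_nonneg _
      have hc : 0 ≤ c := integral_nonneg fun _ => norm_nonneg _
      calc ‖L * A + L * B + C - Λ * L‖ = ‖L * (A - Λ) + L * B + C‖ := by congr 1; ring
        _ ≤ ‖L‖ * ‖A - Λ‖ + ‖L‖ * ‖B‖ + ‖C‖ := by
          rw [← norm_mul, ← norm_mul]
          exact norm_add₃_le
        _ ≤ T * (S * D) + T * b + c := by gcongr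
        _ ≤ T * (S * D) + T * (S * b) + T * (S * c) := by
          have h1 : b ≤ S * b := le_mul_of_one_le_left hb hS
          have h2 : c ≤ T * (S * c) := by
            rw [← mul_assoc]
            exact le_mul_of_one_le_left hc (one_le_mul_of_one_le_of_one_le hT hS)
          gcongr
        _ = S * T * (∫ x, ‖V 0 x - 1‖ ∂ν + (∑ j ∈ Finset.range l,
            (∫ x, ‖r (j + 1) x‖ ∂ν + ∫ x, ‖V (j + 1) x - V j x‖ ∂ν) + (c + b))) := by
          rw [← add_assoc]; ring
  -- The recursion controls the sum weighted by `V N`; removing the weight costs the distance from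
  -- `V N` to 1.
  have hlast : ∫ ω, expSum X w N ω ∂μ = ∫ ω, expSum X w N ω * V N (X N ω) ∂μ -
      ∫ ω, expSum X w N ω * (V N (X N ω) - 1) ∂μ := by
    rw [← integral_sub]
    · refine integral_congr_ae (ae_of_all _ fun ω => ?_)
      simp only
      ring
    · exact hX.integrable_expSum_mul hν hw N N (hV N)
    · exact hX.integrable_expSum_mul hν hw N N ((hV N).sub (integrable_const (1 : ℂ)))
  rw [hlast, sub_right_comm]
  refine (norm_sub_le _ _).trans (add_le_add (hmain N) ?_)
  exact hX.norm_integral_expSum_mul_le hν w N N ((hV N).sub (integrable_const (1 : ℂ)))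

end Product

/-! ### The spectral gap and the Poisson equation -/

section Operators

variable {𝒳 : Type*} [MeasurableSpace 𝒳] {𝓑 : Type*} [NormedAddCommGroup 𝓑] [NormedSpace ℂ 𝓑]
  {ι : 𝓑 →ₗ[ℂ] (𝒳 → ℂ)} {P : Kernel 𝒳 𝒳} {ν : Measure 𝒳}

/-- The operator-theoretic content of conditions (A), (B), (C): `T` is the Markov operator on `𝓑`,
`e` the constant function `1`, and `ℓ` integration against the invariant probability. -/
structure SpectralGap (ι : 𝓑 →ₗ[ℂ] (𝒳 → ℂ)) (P : Kernel 𝒳 𝒳) (ν : Measure 𝒳)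
    (T : 𝓑 →L[ℂ] 𝓑) (e : 𝓑) (ℓ : 𝓑 →L[ℂ] ℂ) : Prop where
  injective : Function.Injective ι
  measurable : ∀ φ, Measurable (ι φ)
  continuous_eval : ∀ x, Continuous (fun φ : 𝓑 => ι φ x)
  represents : Represents ι P (fun _ => 1) T
  map_one : ι e = fun _ => 1
  integrable : ∀ φ, Integrable (ι φ) ν
  mean : ∀ φ, ℓ φ = ∫ x, ι φ x ∂ν
  bound : ∃ K : ℝ, 0 ≤ K ∧ ∀ φ, ∫ x, ‖ι φ x‖ ∂ν ≤ K * ‖φ‖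
  decay : ∃ κ θ : ℝ, 0 ≤ θ ∧ θ < 1 ∧ ∀ (n : ℕ) (φ : 𝓑), ‖(T ^ n) φ - ℓ φ • e‖ ≤ κ * ‖φ‖ * θ ^ n

lemma CondB.integrable_and_bound [IsProbabilityMeasure ν] (hι : IsFunctionSpace ι) {m : ℝ≥0∞}
    (hm : 1 ≤ m) (hB : CondB ι ν m) :
    (∀ φ, Integrable (ι φ) ν) ∧ ∃ K : ℝ, 0 ≤ K ∧ ∀ φ, ∫ x, ‖ι φ x‖ ∂ν ≤ K * ‖φ‖ := by
  obtain ⟨K, hK, h⟩ := hB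
  have hsm (φ) : AEStronglyMeasurable (ι φ) ν := (hι.measurable φ).aestronglyMeasurable
  have h1 (φ) : eLpNorm (ι φ) 1 ν ≤ ENNReal.ofReal (K * ‖φ‖) :=
    (eLpNorm_le_eLpNorm_of_exponent_le hm (hsm φ)).trans (h φ)
  refine ⟨fun φ => memLp_one_iff_integrable.1 ⟨hsm φ, (h1 φ).trans_lt ENNReal.ofReal_lt_top⟩,
    K, hK.le, fun φ => ?_⟩
  rw [integral_norm_eq_lintegral_enorm (hsm φ), ← eLpNorm_one_eq_lintegral_enorm]
  exact ENNReal.toReal_le_of_le_ofReal (by positivity) (h1 φ)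

lemma Represents.iterate {T : 𝓑 →L[ℂ] 𝓑} (hT : Represents ι P (fun _ => 1) T) (n : ℕ) (φ : 𝓑) :
    ι ((T ^ n) φ) = (markovOp P)^[n] (ι φ) := by
  induction n generalizing φ with
  | zero => rfl
  | succ n ih =>
    rw [pow_succ, mul_apply_eq_comp, ih, Function.iterate_succ_apply, (hT φ).2]
    simp only [one_mul]

/-- Serves to identify the derivatives of `t ↦ P_{f,t}` at 0 with operators already fixed. -/
lemma Represents.unique (hι : Function.Injective ι) {w : 𝒳 → ℂ} {A B : 𝓑 →L[ℂ] 𝓑}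
    (hA : Represents ι P w A) (hB : Represents ι P w B) : A = B := by
  ext φ
  exact hι ((hA φ).2.trans (hB φ).2.symm)

lemma Represents.smul {w : 𝒳 → ℂ} {A : 𝓑 →L[ℂ] 𝓑} (hA : Represents ι P w A) (a : ℂ) :
    Represents ι P (fun y => a * w y) (a • A) := by
  refine fun φ => ⟨fun x => ?_, ?_⟩
  · simpa only [mul_assoc] using ((hA φ).1 x).const_mul a
  · funext x
    have h := congrFun (hA φ).2 x
    simp only [smul_apply, map_smul, Pi.smul_apply, h, smul_eq_mul, markovOp,
      mul_assoc, integral_const_mul]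

lemma Represents.sum {J : Type*} (s : Finset J) {w : J → 𝒳 → ℂ} {A : J → 𝓑 →L[ℂ] 𝓑}
    (hA : ∀ j, Represents ι P (w j) (A j)) :
    Represents ι P (fun y => ∑ j ∈ s, w j y) (∑ j ∈ s, A j) := by
  refine fun φ => ⟨fun x => ?_, ?_⟩
  · simp_rw [Finset.sum_mul]
    exact integrable_finsetSum _ fun j _ => (hA j φ).1 x
  · funext x
    simp only [markovOp, Finset.sum_mul, sum_apply, map_sum, Finset.sum_apply]
    rw [integral_finsetSum _ fun j _ => (hA j φ).1 x]
    exact Finset.sum_congr rfl fun j _ => congrFun (hA j φ).2 x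

lemma exists_spectralGap [IsProbabilityMeasure ν] (hι : IsFunctionSpace ι)
    (hP : ActsBoundedly ι P) {m : ℝ≥0∞} (hm : 1 ≤ m) (hA : CondA ι) (hB : CondB ι ν m)
    (hC : CondC ι P ν) : ∃ T e ℓ, SpectralGap ι P ν T e ℓ := by
  obtain ⟨T, hT⟩ := hP
  obtain ⟨e, he⟩ := hA.one_mem
  obtain ⟨hint, K, hK0, hK⟩ := hB.integrable_and_bound hι hm
  obtain ⟨κ, θ, -, hθ0, hθ1, h⟩ := hC
  let L : 𝓑 →ₗ[ℂ] ℂ :=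
    { toFun := fun φ => ∫ x, ι φ x ∂ν
      map_add' := fun φ ψ => by simp [integral_add (hint φ) (hint ψ)]
      map_smul' := fun a φ => by simp [integral_const_mul] }
  refine ⟨T, e, L.mkContinuous K fun φ => (norm_integral_le_integral_norm _).trans (hK φ),
    hι.injective, hι.measurable, hA.continuous_eval, hT, he, hint, fun φ => rfl, ⟨K, hK0, hK⟩,
    κ, θ, hθ0, hθ1, fun n φ => ?_⟩
  obtain ⟨ψ, hψ, hle⟩ := h n φ
  refine le_of_eq_of_le (congrArg norm (hι.injective ?_)) hle
  rw [hψ, map_sub, hT.iterate, map_smul, he]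
  funext x
  simp only [Pi.sub_apply, Pi.smul_apply, smul_eq_mul, mul_one]
  rfl

namespace SpectralGap

variable {T : 𝓑 →L[ℂ] 𝓑} {e : 𝓑} {ℓ : 𝓑 →L[ℂ] ℂ}

lemma map_e [IsMarkovKernel P] (h : SpectralGap ι P ν T e ℓ) : T e = e := by
  apply h.injective
  rw [(h.represents e).2, h.map_one]
  funext x
  simp [markovOp]

lemma mean_e [IsProbabilityMeasure ν] (h : SpectralGap ι P ν T e ℓ) : ℓ e = 1 := by
  simp [h.mean, h.map_one]

lemma mean_of_represents [IsMarkovKernel P] [IsProbabilityMeasure ν]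
    (h : SpectralGap ι P ν T e ℓ) (hν : Kernel.Invariant P ν) {w : 𝒳 → ℂ} {A : 𝓑 →L[ℂ] 𝓑}
    (hA : Represents ι P w A) {φ : 𝓑} (hφ : Integrable (fun x => w x * ι φ x) ν) :
    ℓ (A φ) = ∫ x, w x * ι φ x ∂ν := by
  rw [h.mean, (hA φ).2, (integral_markovOp hν hφ).2]

lemma mean_map [IsMarkovKernel P] [IsProbabilityMeasure ν]
    (h : SpectralGap ι P ν T e ℓ) (hν : Kernel.Invariant P ν) (φ : 𝓑) : ℓ (T φ) = ℓ φ := by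
  rw [h.mean_of_represents hν h.represents (by simpa using h.integrable φ), h.mean]
  simp

/-- The solution of the Poisson equation `h - P h = φ - ν φ`. -/
noncomputable def poisson (T : 𝓑 →L[ℂ] 𝓑) (e : 𝓑) (ℓ : 𝓑 →L[ℂ] ℂ) (φ : 𝓑) : 𝓑 :=
  ∑' n : ℕ, ((T ^ n) φ - ℓ φ • e)

variable [CompleteSpace 𝓑]

lemma hasSum_poisson (h : SpectralGap ι P ν T e ℓ) (φ : 𝓑) :
    HasSum (fun n : ℕ => (T ^ n) φ - ℓ φ • e) (poisson T e ℓ φ) := by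
  obtain ⟨κ, θ, h0, h1, hle⟩ := h.decay
  exact (Summable.of_norm_bounded ((summable_geometric_of_lt_one h0 h1).mul_left (κ * ‖φ‖))
    fun n => hle n φ).hasSum

/-- Since `T e = e`, applying `T` shifts the series by one index, and only its first term survives
in the difference. -/
lemma poisson_sub_map [IsMarkovKernel P] (h : SpectralGap ι P ν T e ℓ) (φ : 𝓑) :
    poisson T e ℓ φ - T (poisson T e ℓ φ) = φ - ℓ φ • e := by
  have h1 := h.hasSum_poisson φ
  have h2 : HasSum (fun n : ℕ => (T ^ (n + 1)) φ - ℓ φ • e) (T (poisson T e ℓ φ)) := by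
    convert! h1.mapL T using 2 with n
    rw [map_sub, map_smul, h.map_e, pow_succ', mul_apply_eq_comp]
  have h3 := (hasSum_nat_add_iff' 1).2 h1
  rw [h2.unique h3]
  simp

lemma mean_poisson [IsMarkovKernel P] [IsProbabilityMeasure ν] (h : SpectralGap ι P ν T e ℓ)
    (hν : Kernel.Invariant P ν) (φ : 𝓑) : ℓ (poisson T e ℓ φ) = 0 := by
  refine ((h.hasSum_poisson φ).mapL ℓ).unique ?_
  have hn (n : ℕ) : ℓ ((T ^ n) φ) = ℓ φ := by
    induction n with
    | zero => rfl
    | succ n ih => rw [pow_succ', mul_apply_eq_comp, h.mean_map hν, ih]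
  have h0 (n : ℕ) : ℓ ((T ^ n) φ - ℓ φ • e) = 0 := by
    rw [map_sub, map_smul, hn, h.mean_e, smul_eq_mul, mul_one, sub_self]
  simp only [h0]
  exact hasSum_zero

omit [CompleteSpace 𝓑] in
lemma _root_.SpectralGapCLT.Represents.im_eq_zero {w : 𝒳 → ℂ} {A : 𝓑 →L[ℂ] 𝓑}
    (hA : Represents ι P w A) (hw : ∀ x, (w x).im = 0) {φ : 𝓑} (hφ : ∀ x, (ι φ x).im = 0) (x : 𝒳) :
    (ι (A φ) x).im = 0 := by
  have h := (hA φ).1 x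
  rw [(hA φ).2, markovOp, ← RCLike.im_eq_complex_im, ← integral_im h]
  simp [hw, hφ]

omit [CompleteSpace 𝓑] in
lemma mean_im_eq_zero (h : SpectralGap ι P ν T e ℓ) {φ : 𝓑} (hφ : ∀ x, (ι φ x).im = 0) :
    (ℓ φ).im = 0 := by
  rw [h.mean, ← RCLike.im_eq_complex_im, ← integral_im (h.integrable φ)]
  simp [hφ]

/-- Point evaluations are continuous, so reality of the terms passes to the sum. This makes the
limiting variances real. -/
lemma poisson_im_eq_zero (h : SpectralGap ι P ν T e ℓ) {φ : 𝓑} (hφ : ∀ x, (ι φ x).im = 0) (x : 𝒳) :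
    (ι (poisson T e ℓ φ) x).im = 0 := by
  have hn (n : ℕ) : ∀ x, (ι ((T ^ n) φ) x).im = 0 := by
    induction n with
    | zero => exact hφ
    | succ n ih =>
      rw [pow_succ', mul_apply_eq_comp]
      exact h.represents.im_eq_zero (by simp) ih
  let E : 𝓑 →L[ℂ] ℂ := ⟨(LinearMap.proj x).comp ι, h.continuous_eval x⟩
  have hs := Complex.hasSum_im ((h.hasSum_poisson φ).mapL E)
  refine hs.unique ?_
  have h0 (n : ℕ) : (E ((T ^ n) φ - ℓ φ • e)).im = 0 := by
    have : E ((T ^ n) φ - ℓ φ • e) = ι ((T ^ n) φ) x - ℓ φ * ι e x := by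
      change ι ((T ^ n) φ - ℓ φ • e) x = _
      simp
    rw [this, h.map_one, Complex.sub_im, hn, mul_one, h.mean_im_eq_zero hφ, sub_zero]
  simp only [h0]
  exact hasSum_zero

end SpectralGap

end Operators

/-! ### Second order expansions and approximate eigenvectors -/

section Perturbation

lemma taylor_two_isLittleO {E : Type*} [NormedAddCommGroup E] [NormedSpace ℝ E] {Q : ℝ → E} {ε : ℝ}
    (hε : 0 < ε) (hQ : ContDiffOn ℝ 2 Q (Set.Ioo (-ε) ε)) :
    (fun t => Q t - (iteratedDeriv 0 Q 0 + t • iteratedDeriv 1 Q 0 +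
      (t ^ 2 / 2) • iteratedDeriv 2 Q 0)) =o[𝓝 0] fun t : ℝ => t ^ 2 := by
  have h0 : (0 : ℝ) ∈ Set.Ioo (-ε) ε := ⟨by linarith, hε⟩
  have h := taylor_isLittleO (convex_Ioo (-ε) ε) h0 (n := 2) (by exact_mod_cast hQ)
  rw [isOpen_Ioo.nhdsWithin_eq h0] at h
  simp only [taylor_within_apply, Finset.sum_range_succ, Finset.sum_range_zero, sub_zero, zero_add,
    iteratedDerivWithin_of_isOpen isOpen_Ioo h0] at h
  refine h.congr_left fun t => ?_
  simp [Nat.factorial, div_eq_inv_mul]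

lemma exp_taylor_isLittleO (c a : ℝ) :
    (fun t : ℝ => Complex.exp (Complex.I * t * c - a * t ^ 2 / 2) -
      (1 + Complex.I * t * c - (c ^ 2 + a) * t ^ 2 / 2)) =o[𝓝 0] fun t : ℝ => t ^ 2 := by
  have hz : Tendsto (fun t : ℝ => Complex.I * t * c - a * t ^ 2 / 2) (𝓝 0) (𝓝 0) := by
    have : Continuous (fun t : ℝ => Complex.I * t * c - a * (t : ℂ) ^ 2 / 2) := by fun_prop
    simpa using this.tendsto 0
  have h3 (n : ℕ) (hn : 2 < n) : (fun t : ℝ => t ^ n) =o[𝓝 0] fun t : ℝ => t ^ 2 :=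
    isLittleO_pow_pow hn
  have hzO : (fun t : ℝ => Complex.I * t * c - a * t ^ 2 / 2) =O[𝓝 0] fun t : ℝ => t := by
    have e : (fun t : ℝ => Complex.I * t * c - a * t ^ 2 / 2) =
        fun t : ℝ => (t : ℂ) * (Complex.I * c - a * t / 2) := by funext t; ring
    have h1 : (fun t : ℝ => (t : ℂ)) =O[𝓝 0] fun t : ℝ => t :=
      IsBigO.of_bound 1 (by simp)
    have h2 : (fun t : ℝ => Complex.I * c - a * t / 2) =O[𝓝 0] fun _ : ℝ => (1 : ℝ) := by
      have : Continuous (fun t : ℝ => Complex.I * c - a * (t : ℂ) / 2) := by fun_prop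
      exact (this.tendsto 0).isBigO_one ℝ
    rw [e]
    simpa using h1.mul h2
  have hexp := ((Complex.exp_sub_sum_range_isBigO_pow 3).comp_tendsto hz).trans (hzO.pow 3)
  have hexp' := hexp.trans_isLittleO (h3 3 (by norm_num))
  -- The part of `z² / 2` beyond order two, for `z = i t c - a t² / 2`.
  have hrest : (fun t : ℝ => -(Complex.I * c * a * (t : ℂ) ^ 3 / 2) + a ^ 2 * t ^ 4 / 8)
      =o[𝓝 0] fun t : ℝ => t ^ 2 := by
    have k (n : ℕ) (b : ℂ) (hn : 2 < n) : (fun t : ℝ => b * (t : ℂ) ^ n) =o[𝓝 0]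
        fun t : ℝ => t ^ 2 := by
      refine IsBigO.trans_isLittleO (IsBigO.of_bound ‖b‖ (Eventually.of_forall fun t => ?_))
        (h3 n hn)
      simp
    refine ((k 3 (-(Complex.I * c * a / 2)) (by norm_num)).add
      (k 4 (a ^ 2 / 8) (by norm_num))).congr_left fun t => ?_
    ring
  refine (hexp'.add hrest).congr_left fun t => ?_
  simp only [Function.comp, Finset.sum_range_succ, Finset.sum_range_zero, Nat.factorial]
  push_cast
  ring_nf
  simp only [Complex.I_sq]
  ring

variable {𝓑 : Type*} [NormedAddCommGroup 𝓑] [NormedSpace ℂ 𝓑]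

/-- Second order expansion of an approximate eigenvector of a `C²` family of operators. -/
lemma approx_eigenvector {Q : ℝ → 𝓑 →L[ℂ] 𝓑} {T D₁ D₂ : 𝓑 →L[ℂ] 𝓑}
    (hQ : (fun t : ℝ => Q t - (T + (t : ℂ) • D₁ + ((t : ℂ) ^ 2 / 2) • D₂)) =o[𝓝 0]
      fun t : ℝ => t ^ 2) {e v₁ v₂ : 𝓑} {c a : ℝ} (h0 : T e = e)
    (h1 : D₁ e + T v₁ = v₁ + (Complex.I * c) • e)
    (h2 : T v₂ + D₁ v₁ + (1 / 2 : ℂ) • D₂ e =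
      v₂ + (Complex.I * c) • v₁ - (((c : ℂ) ^ 2 + a) / 2) • e) :
    (fun t : ℝ => Q t (e + (t : ℂ) • v₁ + (t : ℂ) ^ 2 • v₂) -
      Complex.exp (Complex.I * t * c - a * t ^ 2 / 2) • (e + (t : ℂ) • v₁ + (t : ℂ) ^ 2 • v₂))
      =o[𝓝 0] fun t : ℝ => t ^ 2 := by
  set V : ℝ → 𝓑 := fun t => e + (t : ℂ) • v₁ + (t : ℂ) ^ 2 • v₂ with hV
  have hVc : Continuous V := by fun_prop
  have hV1 : V =O[𝓝 0] fun _ : ℝ => (1 : ℝ) := (hVc.tendsto 0).isBigO_one ℝ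
  have hA : (fun t : ℝ => (Q t - (T + (t : ℂ) • D₁ + ((t : ℂ) ^ 2 / 2) • D₂)) (V t))
      =o[𝓝 0] fun t : ℝ => t ^ 2 := by
    have h := hQ.norm_left.mul_isBigO hV1.norm_left
    simp only [mul_one] at h
    exact IsBigO.trans_isLittleO (IsBigO.of_bound 1 (Eventually.of_forall fun t => by
      rw [one_mul, norm_mul, norm_norm, norm_norm]
      exact ContinuousLinearMap.le_opNorm (Q t - (T + (t : ℂ) • D₁ + ((t : ℂ) ^ 2 / 2) • D₂))
        (V t))) h
  have hB : (fun t : ℝ => (Complex.exp (Complex.I * t * c - a * t ^ 2 / 2) -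
      (1 + Complex.I * t * c - (c ^ 2 + a) * t ^ 2 / 2)) • V t) =o[𝓝 0] fun t : ℝ => t ^ 2 := by
    simpa using (exp_taylor_isLittleO c a).smul_isBigO hV1
  have hC : (fun t : ℝ => (t : ℂ) ^ 3 • (D₁ v₂ + (1 / 2 : ℂ) • D₂ v₁ - (Complex.I * c) • v₂ +
      (((c : ℂ) ^ 2 + a) / 2) • v₁ + (t : ℂ) • ((1 / 2 : ℂ) • D₂ v₂ +
      (((c : ℂ) ^ 2 + a) / 2) • v₂))) =o[𝓝 0] fun t : ℝ => t ^ 2 := by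
    set W : ℝ → 𝓑 := fun t => D₁ v₂ + (1 / 2 : ℂ) • D₂ v₁ - (Complex.I * c) • v₂ +
      (((c : ℂ) ^ 2 + a) / 2) • v₁ + (t : ℂ) • ((1 / 2 : ℂ) • D₂ v₂ +
      (((c : ℂ) ^ 2 + a) / 2) • v₂) with hW
    have hWc : Continuous W := by fun_prop
    have hW1 : W =O[𝓝 0] fun _ : ℝ => (1 : ℝ) := (hWc.tendsto 0).isBigO_one ℝ
    have ht : (fun t : ℝ => (t : ℂ) ^ 3) =o[𝓝 0] fun t : ℝ => t ^ 2 :=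
      IsBigO.trans_isLittleO (IsBigO.of_bound 1 (Eventually.of_forall fun t => by simp))
        (isLittleO_pow_pow (by norm_num : 2 < 3))
    have h := ht.smul_isBigO hW1
    simp only [smul_eq_mul, mul_one] at h
    exact h
  -- Orders 0, 1, 2 cancel by `h0`, `h1`, `h2`. What remains is the two Taylor remainders (`hA`,
  -- `hB`) and the terms of order 3 and 4 (`hC`).
  refine ((hA.sub hB).add hC).congr_left fun t => ?_
  have e1 : D₁ e = v₁ + (Complex.I * c) • e - T v₁ := by rw [← h1]; abel
  have e2 : T v₂ = v₂ + (Complex.I * c) • v₁ - (((c : ℂ) ^ 2 + a) / 2) • e - D₁ v₁ -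
      (1 / 2 : ℂ) • D₂ e := by rw [← h2]; abel
  simp only [hV, sub_apply, add_apply, smul_apply, map_add, map_smul, h0, e1, e2]
  module

end Perturbation

/-! ### Approximate eigenfunctions of the twisted operators -/

section Eigen

variable {𝒳 : Type*} [MeasurableSpace 𝒳] {𝓑 : Type*} [NormedAddCommGroup 𝓑] [NormedSpace ℂ 𝓑]
  {ι : 𝓑 →ₗ[ℂ] (𝒳 → ℂ)} {P : Kernel 𝒳 𝒳} {ν : Measure 𝒳}
  {T : 𝓑 →L[ℂ] 𝓑} {e : 𝓑} {ℓ : 𝓑 →L[ℂ] ℂ}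

lemma CondD.exists_expansion (hι : Function.Injective ι) {C : Submodule ℝ (𝒳 → ℝ)}
    (hD : CondD ι P C) (hT : Represents ι P (fun _ => 1) T) {f : 𝒳 → ℝ} (hf : f ∈ C)
    {R : 𝓑 →L[ℂ] 𝓑} (hR : Represents ι P (fun y => (f y : ℂ)) R) :
    ∃ (Q : ℝ → 𝓑 →L[ℂ] 𝓑) (D : 𝓑 →L[ℂ] 𝓑),
      (∀ᶠ t : ℝ in 𝓝 0, Represents ι P
        (fun y => Complex.exp (Complex.I * (t : ℂ) * (f y : ℂ))) (Q t)) ∧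
      Represents ι P (fun y => -(f y : ℂ) ^ 2) D ∧
      (fun t : ℝ => Q t - (T + (t : ℂ) • (Complex.I • R) + ((t : ℂ) ^ 2 / 2) • D)) =o[𝓝 0]
        fun t : ℝ => t ^ 2 := by
  obtain ⟨ε, Q, hε, hrep, hC2, hder⟩ := hD f hf
  have h := taylor_two_isLittleO hε hC2
  have h0 := hder 0 (by norm_num)
  have h1 := hder 1 (by norm_num)
  have h2 := hder 2 le_rfl
  simp only [pow_zero] at h0
  simp only [pow_one] at h1
  refine ⟨Q, iteratedDeriv 2 Q 0, ?_, ?_, ?_⟩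
  · filter_upwards [Ioo_mem_nhds (neg_lt_zero.2 hε) hε] with t ht using hrep t ht
  · convert h2 using 2 with y
    rw [mul_pow, Complex.I_sq]; ring
  · rw [h0.unique hι hT, h1.unique hι (hR.smul Complex.I)] at h
    refine h.congr_left fun t => ?_
    congr 2
    rw [← Complex.coe_smul]
    push_cast
    rfl

/-- Approximate eigenfunctions for the twisted operators of `f - c`. -/
lemma SpectralGap.exists_approx_eigen [CompleteSpace 𝓑] [IsMarkovKernel P]
    [IsProbabilityMeasure ν] (hS : SpectralGap ι P ν T e ℓ) (hν : Kernel.Invariant P ν)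
    {C : Submodule ℝ (𝒳 → ℝ)} (hD : CondD ι P C) {f : 𝒳 → ℝ} (hf : f ∈ C) (hf2 : MemLp f 2 ν)
    {R : 𝓑 →L[ℂ] 𝓑} (hR : Represents ι P (fun y => (f y : ℂ)) R) {h : 𝓑} {c a : ℝ}
    (hh : h - T h = R e - (c : ℂ) • e) (hℓ : ℓ h = 0)
    (ha : (a : ℂ) = ((∫ x, f x ^ 2 ∂ν : ℝ) : ℂ) - (c : ℂ) ^ 2 + 2 * ℓ (R h)) :
    ∃ V r : ℝ → 𝓑, (∀ᶠ t : ℝ in 𝓝 0, ∀ x, markovOp P (fun y =>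
        Complex.exp (Complex.I * ((t * (f y - c) : ℝ) : ℂ)) * ι (V t) y) x =
        Complex.exp (-((a * t ^ 2 / 2 : ℝ) : ℂ)) * ι (V t) x + ι (r t) x) ∧
      r =o[𝓝 0] (fun t : ℝ => t ^ 2) ∧ (fun t => V t - e) =O[𝓝 0] fun t : ℝ => t := by
  obtain ⟨Q, D, hQ, hDrep, hexp⟩ := hD.exists_expansion hS.injective hS.represents hf hR
  have hDe : ℓ (D e) = -((∫ x, f x ^ 2 ∂ν : ℝ) : ℂ) := by
    have hi : Integrable (fun x => ((f x ^ 2 : ℝ) : ℂ)) ν := hf2.integrable_sq.ofReal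
    have hi' : Integrable (fun x => -(f x : ℂ) ^ 2 * ι e x) ν := by
      rw [hS.map_one]
      simpa using hi.neg
    rw [hS.mean_of_represents hν hDrep hi', hS.map_one, ← integral_complex_ofReal, ← integral_neg]
    simp
  -- With first order coefficient `i h`, the order two equation reads `v - T v = φ`. The value of
  -- `a` in `ha` is the one for which `φ` has mean zero.
  set φ : 𝓑 := -R h + (1 / 2 : ℂ) • D e + (c : ℂ) • h + (((c : ℂ) ^ 2 + a) / 2) • e with hφ
  have hφ0 : ℓ φ = 0 := by
    simp only [hφ, map_add, map_neg, map_smul, hDe, hℓ, hS.mean_e, ha, smul_eq_mul]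
    ring
  set v := poisson T e ℓ φ
  have hv : v - T v = φ := by
    rw [hS.poisson_sub_map, hφ0, zero_smul, sub_zero]
  have h1 : (Complex.I • R) e + T (Complex.I • h) =
      Complex.I • h + (Complex.I * c) • e := by
    have : R e = h - T h + (c : ℂ) • e := by rw [hh]; abel
    rw [smul_apply, this, map_smul]
    module
  have h2 : T v + (Complex.I • R) (Complex.I • h) + (1 / 2 : ℂ) • D e =
      v + (Complex.I * c) • (Complex.I • h) - (((c : ℂ) ^ 2 + a) / 2) • e := by
    have : T v = v - φ := by rw [← hv]; abel
    rw [this, hφ, smul_apply, map_smul, smul_smul, smul_smul, mul_right_comm, Complex.I_mul_I]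
    module
  have hmain := approx_eigenvector hexp hS.map_e h1 h2
  set V : ℝ → 𝓑 := fun t => e + (t : ℂ) • (Complex.I • h) + (t : ℂ) ^ 2 • v with hV
  -- The unimodular factor `e^{-itc}` centres `f` without changing the norm of the error.
  refine ⟨V, fun t => Complex.exp (-(Complex.I * t * c)) • (Q t (V t) -
    Complex.exp (Complex.I * t * c - a * t ^ 2 / 2) • V t), ?_, ?_, ?_⟩
  · filter_upwards [hQ] with t ht x
    have e1 := congrFun (ht (V t)).2 x
    have e2 : markovOp P (fun y =>
        Complex.exp (Complex.I * ((t * (f y - c) : ℝ) : ℂ)) * ι (V t) y) x =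
        Complex.exp (-(Complex.I * t * c)) * ι (Q t (V t)) x := by
      rw [e1, markovOp, markovOp, ← integral_const_mul]
      refine integral_congr_ae (ae_of_all _ fun y => ?_)
      simp only
      rw [← mul_assoc, ← Complex.exp_add]
      congr 2
      push_cast
      ring
    rw [e2]
    simp only [map_smul, map_sub, Pi.smul_apply, Pi.sub_apply, smul_eq_mul, mul_sub]
    rw [← mul_assoc (Complex.exp _) (Complex.exp _), ← Complex.exp_add]
    have e3 : -(Complex.I * t * c) + (Complex.I * t * c - a * t ^ 2 / 2) =
        -((a * t ^ 2 / 2 : ℝ) : ℂ) := by push_cast; ring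
    rw [e3]
    ring
  · refine IsBigO.trans_isLittleO (IsBigO.of_bound 1 (Eventually.of_forall fun t => ?_)) hmain
    have h1 : ‖Complex.exp (-(Complex.I * t * c))‖ = 1 := by
      rw [Complex.norm_exp]
      simp
    rw [norm_smul, h1]
  · have hW : Continuous fun t : ℝ => Complex.I • h + (t : ℂ) • v := by fun_prop
    have hW1 := (hW.tendsto 0).isBigO_one ℝ
    have ht : (fun t : ℝ => (t : ℂ)) =O[𝓝 0] fun t : ℝ => t := IsBigO.of_bound 1 (by simp)
    have := ht.smul hW1
    simp only [smul_eq_mul, mul_one] at this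
    refine this.congr_left fun t => ?_
    simp only [hV]
    module

end Eigen

/-! ### Sums with several time horizons -/

section Combinatorics

lemma sum_range_ite_le {A : Type*} [AddCommMonoid A] {M n : ℕ} (h : M ≤ n) (g : ℕ → A) :
    ∑ l ∈ Finset.range n, (if l + 1 ≤ M then g (l + 1) else 0) = ∑ l ∈ Finset.Icc 1 M, g l := by
  rw [← Finset.sum_filter]
  have : (Finset.range n).filter (fun l => l + 1 ≤ M) = Finset.range M := by
    ext l
    simp only [Finset.mem_filter, Finset.mem_range]
    omega
  rw [this, Finset.range_eq_Ico, Finset.sum_Ico_add' g 0 M 1]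
  rfl

variable {J : Type*} [Fintype J]

/-- The indices whose time horizon `M j` has not been passed at time `l`. -/
def active (M : J → ℕ) (l : ℕ) : Finset J := Finset.univ.filter fun j => l ≤ M j

lemma sum_active {A : Type*} [AddCommMonoid A] {M : J → ℕ} {n : ℕ} (h : ∀ j, M j ≤ n)
    (g : J → ℕ → A) :
    ∑ l ∈ Finset.range n, ∑ j ∈ active M (l + 1), g j (l + 1) =
      ∑ j, ∑ l ∈ Finset.Icc 1 (M j), g j l := by
  simp only [active, Finset.sum_filter]
  rw [Finset.sum_comm]
  exact Finset.sum_congr rfl fun j _ => sum_range_ite_le (h j) (g j)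

/-- A pair is active up to the smaller of its two horizons: this is the origin of `min (t i) (t j)`
in the covariance. -/
lemma sum_active_active {M : J → ℕ} {n : ℕ} (h : ∀ j, M j ≤ n) (g : J → J → ℝ) :
    ∑ l ∈ Finset.range n, ∑ i ∈ active M (l + 1), ∑ j ∈ active M (l + 1), g i j =
      ∑ i, ∑ j, g i j * (min (M i) (M j) : ℕ) := by
  simp only [active, Finset.sum_filter]
  rw [Finset.sum_comm]
  refine Finset.sum_congr rfl fun i _ => ?_
  have e (l : ℕ) : (if l + 1 ≤ M i then ∑ j, (if l + 1 ≤ M j then g i j else 0) else 0) =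
      ∑ j, if l + 1 ≤ min (M i) (M j) then g i j else 0 := by
    by_cases hl : l + 1 ≤ M i <;> simp [hl]
  simp_rw [e]
  rw [Finset.sum_comm]
  refine Finset.sum_congr rfl fun j _ => ?_
  rw [sum_range_ite_le (min_le_of_left_le (h i)) (fun _ => g i j)]
  simp [mul_comm]

/-- Along a decreasing family of subsets, a quantity that vanishes when the subset does not change
has total size controlled by the number of indices. -/
lemma sum_change_le (M : J → ℕ) (n : ℕ) {d : ℕ → ℝ} {b : ℝ} (hb : 0 ≤ b) (hd : ∀ l, d l ≤ b)
    (h0 : ∀ l, active M (l + 1) = active M l → d l ≤ 0) :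
    ∑ l ∈ Finset.range n, d l ≤ b * Fintype.card J := by
  have hsub (l : ℕ) : active M (l + 1) ⊆ active M l := by
    intro j hj
    simp only [active, Finset.mem_filter, Finset.mem_univ, true_and] at hj ⊢
    omega
  -- Each change removes at least one index, so the bound by the loss of cardinality telescopes.
  have key (l : ℕ) : d l ≤ b * ((active M l).card - (active M (l + 1)).card : ℝ) := by
    by_cases h : active M (l + 1) = active M l
    · rw [h, sub_self, mul_zero]
      exact h0 l h
    · have hc := Finset.card_lt_card ((hsub l).ssubset_of_ne h)
      have hc' : ((active M (l + 1)).card : ℝ) + 1 ≤ (active M l).card := by exact_mod_cast hc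
      calc d l ≤ b := hd l
        _ ≤ b * ((active M l).card - (active M (l + 1)).card : ℝ) :=
          le_mul_of_one_le_right hb (by linarith)
  calc ∑ l ∈ Finset.range n, d l
      ≤ ∑ l ∈ Finset.range n, b * ((active M l).card - (active M (l + 1)).card : ℝ) :=
        Finset.sum_le_sum fun l _ => key l
    _ = b * ((active M 0).card - (active M n).card : ℝ) := by
        rw [← Finset.mul_sum, Finset.sum_range_sub' (fun l => ((active M l).card : ℝ))]
    _ ≤ b * Fintype.card J := by
        have : ((active M 0).card : ℝ) ≤ Fintype.card J := by exact_mod_cast Finset.card_le_univ _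
        have h' : (0 : ℝ) ≤ (active M n).card := Nat.cast_nonneg _
        gcongr
        linarith

end Combinatorics

/-! ### Convergence of the characteristic functions -/

section Limit

variable {𝒳 Ω : Type*} [MeasurableSpace 𝒳] [mΩ : MeasurableSpace Ω]
  {μ : Measure Ω} [IsProbabilityMeasure μ] {P : Kernel 𝒳 𝒳} [IsMarkovKernel P]
  {ν : Measure 𝒳} [IsProbabilityMeasure ν] {X : ℕ → Ω → 𝒳}
  {𝓑 : Type*} [NormedAddCommGroup 𝓑] [NormedSpace ℂ 𝓑]
  {ι : 𝓑 →ₗ[ℂ] (𝒳 → ℂ)} {T : 𝓑 →L[ℂ] 𝓑} {e : 𝓑} {ℓ : 𝓑 →L[ℂ] ℂ} {J : Type*} [Fintype J]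

omit [MeasurableSpace 𝒳] mΩ in
-- Turns a linear combination of sums with different horizons into one sum up to `n` with
-- time-dependent summand.
lemma expSum_active (X : ℕ → Ω → 𝒳) {M : J → ℕ} {n : ℕ} (hM : ∀ j, M j ≤ n) (u c : J → ℝ)
    (f : J → 𝒳 → ℝ) (δ : ℝ) (ω : Ω) :
    expSum X (fun l x => δ * (∑ j ∈ active M l, u j * f j x - ∑ j ∈ active M l, u j * c j)) n ω =
      Complex.exp (((∑ j, u j * (δ * ∑ l ∈ Finset.Icc 1 (M j), (f j (X l ω) - c j)) : ℝ) : ℂ) *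
        Complex.I) := by
  unfold expSum
  congr 3
  simp_rw [← Finset.sum_sub_distrib, Finset.mul_sum]
  rw [sum_active hM (fun j l => δ * (u j * f j (X l ω) - u j * c j))]
  refine Finset.sum_congr rfl fun j _ => Finset.sum_congr rfl fun l _ => ?_
  ring

/-- Quantitative estimate from approximate eigenfunctions `V s` of the twisted operators attached to
the functions `∑ j ∈ s, u j * f j`. -/
lemma IsMarkovChain.norm_integral_sub_le_of_eigen (hX : IsMarkovChain μ P ν X)
    (hν : Kernel.Invariant P ν) (hS : SpectralGap ι P ν T e ℓ) {K : ℝ} (hK0 : 0 ≤ K)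
    (hK : ∀ φ, ∫ x, ‖ι φ x‖ ∂ν ≤ K * ‖φ‖) {f : J → 𝒳 → ℝ} (hf : ∀ j, Measurable (f j))
    (u c : J → ℝ) {g : J → J → ℝ} {V r : Finset J → 𝓑} {δ : ℝ}
    (heig : ∀ s x, markovOp P (fun y => Complex.exp (Complex.I *
        ((δ * (∑ j ∈ s, u j * f j y - ∑ j ∈ s, u j * c j) : ℝ) : ℂ)) * ι (V s) y) x =
      Complex.exp (-(((∑ i ∈ s, ∑ j ∈ s, g i j) * δ ^ 2 / 2 : ℝ) : ℂ)) * ι (V s) x + ι (r s) x)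
    {M : J → ℕ} {n : ℕ} (hM : ∀ j, M j ≤ n) :
    ‖∫ ω, Complex.exp (((∑ j, u j * (δ * ∑ l ∈ Finset.Icc 1 (M j), (f j (X l ω) - c j)) : ℝ) : ℂ) *
        Complex.I) ∂μ -
        Complex.exp (-((δ ^ 2 / 2 * ∑ i, ∑ j, g i j * (min (M i) (M j) : ℕ) : ℝ) : ℂ))‖ ≤
      Real.exp ((n * δ ^ 2) * (∑ i, ∑ j, |g i j|) / 2) *
        (K * ∑ s, ‖V s - e‖ + (K * (n * ∑ s, ‖r s‖) +
          2 * (K * ∑ s, ‖V s - e‖) * Fintype.card J)) + K * ∑ s, ‖V s - e‖ := by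
  have hVle (s : Finset J) : ‖V s - e‖ ≤ ∑ s, ‖V s - e‖ :=
    Finset.single_le_sum (f := fun s => ‖V s - e‖) (fun _ _ => norm_nonneg _) (Finset.mem_univ s)
  have hrle (s : Finset J) : ‖r s‖ ≤ ∑ s, ‖r s‖ :=
    Finset.single_le_sum (f := fun s => ‖r s‖) (fun _ _ => norm_nonneg _) (Finset.mem_univ s)
  have hV1 (s : Finset J) : ∫ x, ‖ι (V s) x - 1‖ ∂ν ≤ K * ∑ s, ‖V s - e‖ := by
    have h := hK (V s - e)
    simp only [map_sub, hS.map_one, Pi.sub_apply] at h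
    exact h.trans (mul_le_mul_of_nonneg_left (hVle s) hK0)
  have hVV (s s' : Finset J) : ∫ x, ‖ι (V s) x - ι (V s') x‖ ∂ν ≤ 2 * (K * ∑ s, ‖V s - e‖) := by
    have h := hK (V s - V s')
    simp only [map_sub, Pi.sub_apply] at h
    refine h.trans ?_
    have h1 : ‖V s - V s'‖ ≤ 2 * ∑ s, ‖V s - e‖ := by
      calc ‖V s - V s'‖ ≤ ‖V s - e‖ + ‖V s' - e‖ := by
            rw [← sub_sub_sub_cancel_right (V s) (V s') e]; exact norm_sub_le _ _
        _ ≤ _ := by linarith [hVle s, hVle s']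
    calc K * ‖V s - V s'‖ ≤ K * (2 * ∑ s, ‖V s - e‖) := mul_le_mul_of_nonneg_left h1 hK0
      _ = _ := by ring
  have hr1 (s : Finset J) : ∫ x, ‖ι (r s) x‖ ∂ν ≤ K * ∑ s, ‖r s‖ :=
    (hK (r s)).trans (mul_le_mul_of_nonneg_left (hrle s) hK0)
  have hg (s : Finset J) : |∑ i ∈ s, ∑ j ∈ s, g i j| ≤ ∑ i, ∑ j, |g i j| := by
    refine (Finset.abs_sum_le_sum_abs _ _).trans ((Finset.sum_le_sum fun i _ =>
      Finset.abs_sum_le_sum_abs _ _).trans ?_)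
    calc ∑ i ∈ s, ∑ j ∈ s, |g i j| ≤ ∑ i ∈ s, ∑ j, |g i j| :=
          Finset.sum_le_sum fun i _ => Finset.sum_le_sum_of_subset_of_nonneg
            (Finset.subset_univ s) fun _ _ _ => abs_nonneg _
      _ ≤ ∑ i, ∑ j, |g i j| := Finset.sum_le_sum_of_subset_of_nonneg (Finset.subset_univ s)
            fun _ _ _ => Finset.sum_nonneg fun _ _ => abs_nonneg _
  have h := hX.norm_integral_expSum_sub_le hν
    (w := fun l x => δ * (∑ j ∈ active M l, u j * f j x - ∑ j ∈ active M l, u j * c j))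
    (fun l => by fun_prop) (V := fun l => ι (V (active M l))) (r := fun l => ι (r (active M l)))
    (s := fun l => (∑ i ∈ active M l, ∑ j ∈ active M l, g i j) * δ ^ 2 / 2)
    (fun l => hS.measurable _) (fun l => hS.integrable _) (fun l => hS.integrable _)
    (fun l x => heig (active M l) x) n
  simp_rw [expSum_active X hM] at h
  have hsum : ∑ l ∈ Finset.range n,
      (∑ i ∈ active M (l + 1), ∑ j ∈ active M (l + 1), g i j) * δ ^ 2 / 2 =
      δ ^ 2 / 2 * ∑ i, ∑ j, g i j * (min (M i) (M j) : ℕ) := by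
    rw [← sum_active_active hM, Finset.mul_sum]
    exact Finset.sum_congr rfl fun l _ => by ring
  rw [hsum] at h
  refine h.trans ?_
  have hexp : ∑ l ∈ Finset.range n,
      |(∑ i ∈ active M (l + 1), ∑ j ∈ active M (l + 1), g i j) * δ ^ 2 / 2| ≤
      (n * δ ^ 2) * (∑ i, ∑ j, |g i j|) / 2 := by
    calc _ ≤ ∑ l ∈ Finset.range n, (∑ i, ∑ j, |g i j|) * δ ^ 2 / 2 := by
          refine Finset.sum_le_sum fun l _ => ?_
          rw [abs_div, abs_mul, abs_of_nonneg (sq_nonneg δ), abs_two]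
          have := hg (active M (l + 1))
          gcongr
      _ = _ := by simp; ring
  have hrsum : ∑ l ∈ Finset.range n, ∫ x, ‖ι (r (active M (l + 1))) x‖ ∂ν ≤
      K * (n * ∑ s, ‖r s‖) := by
    calc _ ≤ ∑ l ∈ Finset.range n, K * ∑ s, ‖r s‖ := Finset.sum_le_sum fun l _ => hr1 _
      _ = _ := by simp; ring
  -- The difference vanishes unless the active set changes, so this total does not grow with `n`.
  have hVsum : ∑ l ∈ Finset.range n,
      ∫ x, ‖ι (V (active M (l + 1))) x - ι (V (active M l)) x‖ ∂ν ≤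
      2 * (K * ∑ s, ‖V s - e‖) * Fintype.card J := by
    refine sum_change_le M n (by positivity) (fun l => hVV _ _) fun l hl => ?_
    rw [hl]
    simp
  rw [Finset.sum_add_distrib]
  gcongr
  · exact hV1 _
  · exact hV1 _

lemma tendsto_inv_mul_min_floor {a b : ℝ} (ha : 0 ≤ a) (hb : 0 ≤ b) :
    Tendsto (fun n : ℕ => (n : ℝ)⁻¹ * (min ⌊(n : ℝ) * a⌋₊ ⌊(n : ℝ) * b⌋₊ : ℕ)) atTop
      (𝓝 (min a b)) := by
  have h (x : ℝ) (hx : 0 ≤ x) : Tendsto (fun n : ℕ => (n : ℝ)⁻¹ * (⌊(n : ℝ) * x⌋₊ : ℝ)) atTop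
      (𝓝 x) := by
    refine ((tendsto_nat_floor_mul_div_atTop hx).comp tendsto_natCast_atTop_atTop).congr
      fun n => ?_
    simp only [Function.comp, mul_comm x, div_eq_inv_mul]
  refine ((h a ha).min (h b hb)).congr fun n => ?_
  rw [← mul_min_of_nonneg _ _ (by positivity), Nat.cast_min]

/-- Convergence of the characteristic functions of the normalized partial sums. -/
theorem IsMarkovChain.tendsto_integral_exp [CompleteSpace 𝓑] (hX : IsMarkovChain μ P ν X)
    (hν : Kernel.Invariant P ν) (hS : SpectralGap ι P ν T e ℓ) {f : J → 𝒳 → ℝ}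
    (hf : ∀ j, Measurable (f j)) (hf2 : ∀ j, MemLp (f j) 2 ν)
    (hD : CondD ι P (Submodule.span ℝ (Set.range f))) {R : J → 𝓑 →L[ℂ] 𝓑}
    (hR : ∀ j, Represents ι P (fun y => (f j y : ℂ)) (R j)) {c : J → ℝ} {h : J → 𝓑}
    (hh : ∀ j, h j - T (h j) = R j e - (c j : ℂ) • e) (hℓ : ∀ j, ℓ (h j) = 0) {q : J → J → ℝ}
    (hq : ∀ i j, (q i j : ℂ) = ((∫ x, f i x * f j x ∂ν - c i * c j : ℝ) : ℂ) + 2 * ℓ (R i (h j)))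
    {t : J → ℝ} (ht : ∀ j, t j ∈ Set.Icc (0 : ℝ) 1) (u : J → ℝ) :
    Tendsto (fun n : ℕ => ∫ ω, Complex.exp (((∑ j, u j * ((Real.sqrt n)⁻¹ *
        partialSum X n (fun x => f j x - c j) (t j) ω) : ℝ) : ℂ) * Complex.I) ∂μ) atTop
      (𝓝 (Complex.exp (-((1 / 2 * ∑ i, ∑ j, u i * u j * q i j * min (t i) (t j) : ℝ) : ℂ)))) := by
  obtain ⟨K, hK0, hK⟩ := hS.bound
  -- Every subset `s` is a possible active set. The Poisson solution for its combination of the `f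
  -- j` is the same combination of the `h j`.
  have hex (s : Finset J) := hS.exists_approx_eigen hν hD
    (f := fun x => ∑ j ∈ s, u j * f j x) (R := ∑ j ∈ s, (u j : ℂ) • R j)
    (h := ∑ j ∈ s, (u j : ℂ) • h j) (c := ∑ j ∈ s, u j * c j)
    (a := ∑ i ∈ s, ∑ j ∈ s, u i * u j * q i j)
    (by
      have : (fun x => ∑ j ∈ s, u j * f j x) = ∑ j ∈ s, u j • f j := by
        funext x; simp
      rw [this]
      exact Submodule.sum_mem _ fun j _ =>
        Submodule.smul_mem _ _ (Submodule.subset_span ⟨j, rfl⟩))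
    (memLp_finsetSum _ fun j _ => (hf2 j).const_mul _)
    (by
      have := Represents.sum s (fun j => (hR j).smul (u j : ℂ))
      simpa only [Complex.ofReal_sum, Complex.ofReal_mul] using this)
    (by
      simp only [map_sum, map_smul, ← Finset.sum_sub_distrib, ← smul_sub, hh, sum_apply,
        smul_apply, Complex.ofReal_sum, Complex.ofReal_mul, Finset.sum_smul]
      refine Finset.sum_congr rfl fun j _ => ?_
      module)
    (by simp [hℓ])
    (by
      have hi (i j : J) : Integrable (fun x => u i * u j * (f i x * f j x)) ν :=
        ((hf2 i).integrable_mul (hf2 j)).const_mul _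
      have e1 : ∫ x, (∑ j ∈ s, u j * f j x) ^ 2 ∂ν =
          ∑ i ∈ s, ∑ j ∈ s, u i * u j * ∫ x, f i x * f j x ∂ν := by
        simp_rw [sq, Finset.sum_mul_sum]
        have : ∀ x i j, u i * f i x * (u j * f j x) = u i * u j * (f i x * f j x) := by
          intros; ring
        simp_rw [this]
        rw [integral_finsetSum _ fun i _ => integrable_finsetSum _ fun j _ => hi i j]
        refine Finset.sum_congr rfl fun i _ => ?_
        rw [integral_finsetSum _ fun j _ => hi i j]
        simp_rw [integral_const_mul]
      have e2 : ℓ ((∑ j ∈ s, (u j : ℂ) • R j) (∑ j ∈ s, (u j : ℂ) • h j)) =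
          ∑ i ∈ s, ∑ j ∈ s, (u i : ℂ) * u j * ℓ (R i (h j)) := by
        simp only [sum_apply, smul_apply, map_sum, map_smul, smul_eq_mul, Finset.mul_sum, mul_assoc]
        rw [Finset.sum_comm]
        simp only [mul_left_comm]
      rw [e1, e2]
      push_cast
      simp only [hq]
      rw [sq, Finset.sum_mul_sum, Finset.mul_sum, ← Finset.sum_sub_distrib,
        ← Finset.sum_add_distrib]
      refine Finset.sum_congr rfl fun i _ => ?_
      rw [Finset.mul_sum, ← Finset.sum_sub_distrib, ← Finset.sum_add_distrib]
      refine Finset.sum_congr rfl fun j _ => ?_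
      push_cast
      ring)
  choose V r heig hr hV using hex
  set δ : ℕ → ℝ := fun n => (Real.sqrt n)⁻¹ with hδ
  have hδ0 : Tendsto δ atTop (𝓝 0) :=
    tendsto_inv_atTop_zero.comp (Real.tendsto_sqrt_atTop.comp tendsto_natCast_atTop_atTop)
  have hδ2 (n : ℕ) : δ n ^ 2 = (n : ℝ)⁻¹ := by
    rw [hδ, inv_pow, Real.sq_sqrt (Nat.cast_nonneg n)]
  have hG : Tendsto (fun n => ∑ s, ‖V s (δ n) - e‖) atTop (𝓝 0) := by
    rw [← Finset.sum_const_zero (s := (Finset.univ : Finset (Finset J)))]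
    refine tendsto_finsetSum _ fun s _ => ?_
    exact tendsto_zero_iff_norm_tendsto_zero.1
      (((hV s).comp_tendsto hδ0).trans_tendsto hδ0)
  -- `r s = o(t²)` at `t = n^{-1/2}` is `o(1/n)`, which survives `n` steps.
  have hρ : Tendsto (fun n : ℕ => (n : ℝ) * ∑ s, ‖r s (δ n)‖) atTop (𝓝 0) := by
    simp_rw [Finset.mul_sum]
    rw [← Finset.sum_const_zero (s := (Finset.univ : Finset (Finset J)))]
    refine tendsto_finsetSum _ fun s _ => ?_
    have := (((hr s).comp_tendsto hδ0).norm_left).tendsto_div_nhds_zero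
    refine this.congr fun n => ?_
    simp only [Function.comp, hδ2, div_inv_eq_mul, mul_comm]
  have hM (n : ℕ) (j : J) : ⌊(n : ℝ) * t j⌋₊ ≤ n :=
    Nat.floor_le_of_le (mul_le_of_le_one_right (Nat.cast_nonneg n) (ht j).2)
  -- There are finitely many subsets, so one threshold on `n` serves them all.
  have hev : ∀ᶠ n : ℕ in atTop, _ := hδ0.eventually (eventually_all.2 heig)
  have hlim : Tendsto (fun n : ℕ => Complex.exp (-((δ n ^ 2 / 2 * ∑ i, ∑ j, u i * u j * q i j *
      (min ⌊(n : ℝ) * t i⌋₊ ⌊(n : ℝ) * t j⌋₊ : ℕ) : ℝ) : ℂ))) atTop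
      (𝓝 (Complex.exp (-((1 / 2 * ∑ i, ∑ j, u i * u j * q i j * min (t i) (t j) : ℝ) : ℂ)))) := by
    refine (Complex.continuous_exp.tendsto _).comp (Tendsto.neg
      ((Complex.continuous_ofReal.tendsto _).comp ?_))
    have : Tendsto (fun n : ℕ => 1 / 2 * ∑ i, ∑ j, u i * u j * q i j *
        ((n : ℝ)⁻¹ * (min ⌊(n : ℝ) * t i⌋₊ ⌊(n : ℝ) * t j⌋₊ : ℕ))) atTop
        (𝓝 (1 / 2 * ∑ i, ∑ j, u i * u j * q i j * min (t i) (t j))) :=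
      Tendsto.const_mul _ (tendsto_finsetSum _ fun i _ => tendsto_finsetSum _ fun j _ =>
        (tendsto_inv_mul_min_floor (ht i).1 (ht j).1).const_mul _)
    refine this.congr fun n => ?_
    have e : (n : ℝ)⁻¹ / 2 = 1 / 2 * (n : ℝ)⁻¹ := by ring
    rw [hδ2, e, mul_assoc (1 / 2 : ℝ) (n : ℝ)⁻¹, Finset.mul_sum (a := (n : ℝ)⁻¹)]
    congr 1
    refine Finset.sum_congr rfl fun i _ => ?_
    rw [Finset.mul_sum]
    exact Finset.sum_congr rfl fun j _ => by ring
  refine tendsto_of_tendsto_of_dist hlim ?_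
  have hbound : Tendsto (fun n : ℕ => Real.exp (1 * (∑ i, ∑ j, |u i * u j * q i j|) / 2) *
        (K * ∑ s, ‖V s (δ n) - e‖ + (K * (n * ∑ s, ‖r s (δ n)‖) +
          2 * (K * ∑ s, ‖V s (δ n) - e‖) * Fintype.card J)) + K * ∑ s, ‖V s (δ n) - e‖)
      atTop (𝓝 0) := by
    have h1 := hG.const_mul K
    have h2 := hρ.const_mul K
    simpa using ((h1.add (h2.add ((h1.const_mul 2).mul_const (Fintype.card J : ℝ)))).const_mul
      (Real.exp (1 * (∑ i, ∑ j, |u i * u j * q i j|) / 2))).add h1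
  refine squeeze_zero' (Eventually.of_forall fun _ => dist_nonneg) ?_ hbound
  filter_upwards [hev, eventually_gt_atTop 0] with n hn hn0
  rw [dist_comm, dist_eq_norm]
  have := hX.norm_integral_sub_le_of_eigen hν hS hK0 hK hf u c
    (g := fun i j => u i * u j * q i j) (V := fun s => V s (δ n)) (r := fun s => r s (δ n))
    hn (hM n)
  rw [hδ2, mul_inv_cancel₀ (by positivity)] at this
  rw [hδ2]
  exact this

end Limit

/-! ### The covariance series -/

section Covariance

variable {𝒳 Ω : Type*} [MeasurableSpace 𝒳] [mΩ : MeasurableSpace Ω]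
  {μ : Measure Ω} [IsProbabilityMeasure μ] {P : Kernel 𝒳 𝒳} [IsMarkovKernel P]
  {ν : Measure 𝒳} [IsProbabilityMeasure ν] {X : ℕ → Ω → 𝒳}
  {𝓑 : Type*} [NormedAddCommGroup 𝓑] [NormedSpace ℂ 𝓑]
  {ι : 𝓑 →ₗ[ℂ] (𝒳 → ℂ)} {T : 𝓑 →L[ℂ] 𝓑} {e : 𝓑} {ℓ : 𝓑 →L[ℂ] ℂ}

omit [IsMarkovKernel P] in
-- The first derivative of `P_{f,t}` at 0 is `φ ↦ P (i f φ)`; dividing by `i` gives `R`.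
lemma CondD.exists_represents {C : Submodule ℝ (𝒳 → ℝ)} (hD : CondD ι P C) {f : 𝒳 → ℝ}
    (hf : f ∈ C) : ∃ R : 𝓑 →L[ℂ] 𝓑, Represents ι P (fun y => (f y : ℂ)) R := by
  obtain ⟨ε, Q, -, -, -, h⟩ := hD f hf
  refine ⟨(-Complex.I) • iteratedDeriv 1 Q 0, ?_⟩
  convert (h 1 (by norm_num)).smul (-Complex.I) using 2 with y
  rw [pow_one, ← mul_assoc, neg_mul, Complex.I_mul_I, neg_neg, one_mul]

omit [IsProbabilityMeasure ν] in
lemma IsMarkovChain.memLp_comp (hX : IsMarkovChain μ P ν X) (hν : Kernel.Invariant P ν) {p : ℝ≥0∞}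
    {f : 𝒳 → ℝ} (hf : MemLp f p ν) (n : ℕ) : MemLp (fun ω => f (X n ω)) p μ := by
  rw [← hX.map_eq hν n] at hf
  exact hf.comp_of_map (hX.measurable n).aemeasurable

omit [IsProbabilityMeasure ν] in
lemma IsMarkovChain.integral_comp (hX : IsMarkovChain μ P ν X) (hν : Kernel.Invariant P ν)
    {f : 𝒳 → ℝ} (hf : Measurable f) (n : ℕ) : ∫ ω, f (X n ω) ∂μ = ∫ x, f x ∂ν := by
  rw [← hX.map_eq hν n, integral_map (hX.measurable n).aemeasurable hf.aestronglyMeasurable]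

omit [IsProbabilityMeasure ν] in
lemma IsMarkovChain.covariance_zero (hX : IsMarkovChain μ P ν X) (hν : Kernel.Invariant P ν)
    {g f : 𝒳 → ℝ} (hg : Measurable g) (hg2 : MemLp g 2 ν) (hf : Measurable f)
    (hf2 : MemLp f 2 ν) : cov[fun ω => g (X 0 ω), fun ω => f (X 0 ω); μ] =
      ∫ x, g x * f x ∂ν - (∫ x, g x ∂ν) * ∫ x, f x ∂ν := by
  rw [covariance_eq_sub (hX.memLp_comp hν hg2 0) (hX.memLp_comp hν hf2 0),
    hX.integral_comp hν hg, hX.integral_comp hν hf,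
    ← hX.integral_comp hν (f := fun x => g x * f x) (hg.mul hf) 0]
  rfl

/-- The covariances along the chain sum up to the mean of `g` times the solution of the Poisson
equation for `P f`. -/
lemma IsMarkovChain.hasSum_covariance [CompleteSpace 𝓑] (hX : IsMarkovChain μ P ν X)
    (hν : Kernel.Invariant P ν) (hS : SpectralGap ι P ν T e ℓ) {m s : ℝ≥0∞}
    [ENNReal.HolderConjugate s m] (hm : ∀ φ, MemLp (ι φ) m ν) {g f : 𝒳 → ℝ} (hg : Measurable g)
    (hg2 : MemLp g 2 ν) (hgs : MemLp g s ν) (hf : Measurable f) (hf2 : MemLp f 2 ν)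
    {R : 𝓑 →L[ℂ] 𝓑} (hR : Represents ι P (fun y => (g y : ℂ)) R) {φ : 𝓑}
    (hφ : ι φ = fun x => (f x : ℂ)) :
    HasSum (fun n : ℕ => cov[fun ω => g (X 0 ω), fun ω => f (X (n + 1) ω); μ])
      (ℓ (R (SpectralGap.poisson T e ℓ (T φ)))).re := by
  have hgm : Measurable fun x => (g x : ℂ) := Complex.measurable_ofReal.comp hg
  -- Hölder for `L^s` and `L^m`; it gives `ℓ (R ψ) = ν (g ψ)`.
  have hint (ψ : 𝓑) : Integrable (fun x => (g x : ℂ) * ι ψ x) ν :=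
    hgs.ofReal.integrable_mul (hm ψ)
  have hℓφ : ℓ φ = ((∫ x, f x ∂ν : ℝ) : ℂ) := by
    rw [hS.mean, hφ, integral_complex_ofReal]
  -- The series starts from `T φ`, so its term of index `n` contains `P^{n+1} f` and has lag `n +
  -- 1`.
  have hterm (n : ℕ) : ℓ (R ((T ^ n) (T φ) - ℓ (T φ) • e)) =
      ((cov[fun ω => g (X 0 ω), fun ω => f (X (n + 1) ω); μ] : ℝ) : ℂ) := by
    have hi : Integrable (fun ω => (g (X 0 ω) : ℂ) * (f (X (n + 1) ω) : ℂ)) μ :=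
      (hX.memLp_comp hν hg2 0).ofReal.integrable_mul (hX.memLp_comp hν hf2 (n + 1)).ofReal
    have h1 := hX.integral_mul_iterate hgm (n + 1) (Complex.measurable_ofReal.comp hf) hi
    have e1 : (T ^ n) (T φ) = (T ^ (n + 1)) φ := by rw [pow_succ, mul_apply_eq_comp]
    rw [map_sub, map_sub, map_smul, map_smul, hS.mean_map hν, hℓφ, e1,
      hS.mean_of_represents hν hR (hint _), hS.mean_of_represents hν hR (hint _),
      hS.represents.iterate, hφ, hS.map_one,
      covariance_eq_sub (hX.memLp_comp hν hg2 0) (hX.memLp_comp hν hf2 (n + 1)),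
      hX.integral_comp hν hg, hX.integral_comp hν hf]
    have h2 : ∫ x, (g x : ℂ) * (markovOp P)^[n + 1] (fun x => (f x : ℂ)) x ∂ν =
        ((∫ ω, g (X 0 ω) * f (X (n + 1) ω) ∂μ : ℝ) : ℂ) := by
      rw [← integral_complex_ofReal]
      simp_rw [Complex.ofReal_mul]
      exact h1.symm
    rw [h2]
    simp only [mul_one, integral_complex_ofReal, smul_eq_mul, Pi.mul_apply]
    push_cast
    ring
  have h := Complex.hasSum_re (((hS.hasSum_poisson (T φ)).mapL R).mapL ℓ)
  simpa only [hterm, Complex.ofReal_re] using h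

end Covariance

end SpectralGapCLT

/-! ### The central limit theorem -/

theorem mainTheorem7
    {𝒳 : Type*} [MeasurableSpace 𝒳]
    {Ω : Type*} [MeasurableSpace Ω] (μ : Measure Ω) [IsProbabilityMeasure μ]
    -- the chain, started from the invariant probability `ν`
    (P : Kernel 𝒳 𝒳) [IsMarkovKernel P] (ν : Measure 𝒳) [IsProbabilityMeasure ν]
    (hν : Kernel.Invariant P ν)
    (X : ℕ → Ω → 𝒳) (hX : SpectralGapCLT.IsMarkovChain μ P ν X)
    -- the complex Banach space of measurable functions on which `P` acts
    {𝓑 : Type*} [NormedAddCommGroup 𝓑] [NormedSpace ℂ 𝓑] [CompleteSpace 𝓑]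
    (ι : 𝓑 →ₗ[ℂ] (𝒳 → ℂ)) (hι : SpectralGapCLT.IsFunctionSpace ι)
    (hP : SpectralGapCLT.ActsBoundedly ι P)
    -- `1 ≤ m ≤ ∞` and `s = m / (m - 1)`, i.e. `1 / m + 1 / s = 1`
    (m s : ℝ≥0∞) (hms : ENNReal.HolderConjugate m s)
    (hA : SpectralGapCLT.CondA ι)
    (hB : SpectralGapCLT.CondB ι ν m)
    (hC : SpectralGapCLT.CondC ι P ν)
    (k : ℕ) (hk : 0 < k)
    (t : Fin k → ℝ) (ht : ∀ i, t i ∈ Set.Icc (0 : ℝ) 1)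
    (f : Fin k → 𝒳 → ℝ) (hf_meas : ∀ i, Measurable (f i)) (hf_sq : ∀ i, MemLp (f i) 2 ν)
    (hD : SpectralGapCLT.CondD ι P (Submodule.span ℝ (Set.range f))) :
    ∃ S : Matrix (Fin k) (Fin k) ℝ, S.PosSemidef ∧
      TendstoInDistribution
        (fun (n : ℕ) (ω : Ω) => WithLp.toLp 2 (fun i : Fin k =>
          (Real.sqrt n)⁻¹ *
            SpectralGapCLT.partialSum X n (fun x => f i x - ∫ y, f i y ∂ν) (t i) ω))
        atTop (id : EuclideanSpace ℝ (Fin k) → EuclideanSpace ℝ (Fin k))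
        (fun _ => μ) (multivariateGaussian 0 S) ∧
      ((∀ i, MemLp (f i) s ν ∧ (fun x => (f i x : ℂ)) ∈ LinearMap.range ι) →
        ∀ i j,
          Summable (fun l : ℕ => cov[fun ω => f i (X 0 ω), fun ω => f j (X l ω); μ]) ∧
          Summable (fun l : ℕ => cov[fun ω => f j (X 0 ω), fun ω => f i (X (l + 1) ω); μ]) ∧
          S i j = min (t i) (t j) *
            ((∑' l : ℕ, cov[fun ω => f i (X 0 ω), fun ω => f j (X l ω); μ]) +
              ∑' l : ℕ, cov[fun ω => f j (X 0 ω), fun ω => f i (X (l + 1) ω); μ])) := by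
  open SpectralGapCLT in
  obtain ⟨T, e, ℓ, hS⟩ := exists_spectralGap hι hP (ENNReal.HolderConjugate.one_le m s) hA hB hC
  have hm (φ : 𝓑) : MemLp (ι φ) m ν := by
    obtain ⟨K, -, h⟩ := hB
    exact ⟨(hι.measurable φ).aestronglyMeasurable, (h φ).trans_lt ENNReal.ofReal_lt_top⟩
  choose R hR using fun j => hD.exists_represents (Submodule.subset_span (Set.mem_range_self j))
  set c : Fin k → ℝ := fun j => ∫ x, f j x ∂ν with hc
  have hRe (j) : ℓ (R j e) = c j := by
    rw [hS.mean_of_represents hν (hR j), hS.map_one]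
    · simp only [mul_one, integral_complex_ofReal, hc]
    · have hi : Integrable (fun x => (f j x : ℂ)) ν :=
        ((hf_sq j).integrable one_le_two).ofReal
      simpa only [hS.map_one, mul_one] using hi
  -- The Poisson equation is posed for `R j e`, that is `P (f j)`, because `f j` itself need not lie
  -- in `𝓑`.
  set h : Fin k → 𝓑 := fun j => SpectralGapCLT.SpectralGap.poisson T e ℓ (R j e) with hh
  have hpoisson (j) : h j - T (h j) = R j e - (c j : ℂ) • e := by
    rw [hh, hS.poisson_sub_map, hRe]
  have hreal (i j) : (ℓ (R i (h j))).im = 0 :=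
    hS.mean_im_eq_zero ((hR i).im_eq_zero (by simp) (hS.poisson_im_eq_zero
      ((hR j).im_eq_zero (by simp) (by simp [hS.map_one]))))
  set d : Fin k → Fin k → ℝ := fun i j => (ℓ (R i (h j))).re with hd
  set b : Fin k → Fin k → ℝ := fun i j => ∫ x, f i x * f j x ∂ν - c i * c j with hb
  have hbs (i j) : b i j = b j i := by simp only [hb, mul_comm]
  have hlim := hX.tendsto_integral_exp hν hS hf_meas hf_sq hD hR hpoisson
    (fun j => hS.mean_poisson hν _) (q := fun i j => b i j + 2 * d i j)
    (fun i j => by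
      have : ℓ (R i (h j)) = (d i j : ℂ) := Complex.ext rfl (by simp [hreal])
      rw [this]
      simp only [hb]
      push_cast
      ring) ht
  -- `d` need not be symmetric; `d i j + d j i` gives the same quadratic form as `2 * d i j`.
  set S : Matrix (Fin k) (Fin k) ℝ :=
    fun i j => min (t i) (t j) * (b i j + d i j + d j i) with hSdef
  have hquad (u : Fin k → ℝ) : u ⬝ᵥ S.mulVec u =
      ∑ i, ∑ j, u i * u j * (b i j + 2 * d i j) * min (t i) (t j) := by
    have e1 : u ⬝ᵥ S.mulVec u = ∑ i, ∑ j, u i * u j * (b i j + d i j) * min (t i) (t j) +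
        ∑ i, ∑ j, u i * u j * d j i * min (t i) (t j) := by
      simp only [dotProduct, Matrix.mulVec, Finset.mul_sum, ← Finset.sum_add_distrib, hSdef]
      exact Finset.sum_congr rfl fun i _ => Finset.sum_congr rfl fun j _ => by ring
    rw [e1, Finset.sum_comm (f := fun i j => u i * u j * d j i * min (t i) (t j)),
      ← Finset.sum_add_distrib]
    refine Finset.sum_congr rfl fun i _ => ?_
    rw [← Finset.sum_add_distrib]
    refine Finset.sum_congr rfl fun j _ => ?_
    rw [min_comm (t j)]
    ring
  have hpsd : S.PosSemidef := by
    refine Matrix.PosSemidef.of_dotProduct_mulVec_nonneg ?_ fun u => ?_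
    · refine Matrix.IsHermitian.ext fun i j => ?_
      change min (t j) (t i) * (b j i + d j i + d i j) = min (t i) (t j) * (b i j + d i j + d j i)
      rw [min_comm, hbs j i]
      ring
    · rw [star_trivial, hquad]
      -- A limit of characteristic functions has modulus at most 1, so the quadratic form is
      -- nonnegative.
      have h1 : ‖Complex.exp (-((1 / 2 * ∑ i, ∑ j, u i * u j * (b i j + 2 * d i j) *
          min (t i) (t j) : ℝ) : ℂ))‖ ≤ 1 := by
        refine le_of_tendsto (hlim u).norm (Eventually.of_forall fun n => ?_)
        refine (norm_integral_le_integral_norm _).trans ?_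
        simp_rw [Complex.norm_exp_ofReal_mul_I]
        simp
      rw [Complex.norm_exp, Real.exp_le_one_iff, Complex.neg_re, Complex.ofReal_re] at h1
      linarith
  refine ⟨S, hpsd, ?_, fun hs i j => ?_⟩
  · have hmeas (n : ℕ) : Measurable fun ω => WithLp.toLp 2 (fun i : Fin k => (Real.sqrt n)⁻¹ *
        SpectralGapCLT.partialSum X n (fun x => f i x - ∫ y, f i y ∂ν) (t i) ω) := by
      refine (WithLp.measurable_toLp 2 _).comp (measurable_pi_lambda _ fun i => ?_)
      refine Measurable.const_mul (Finset.measurable_sum _ fun j _ => ?_) _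
      exact ((hf_meas i).comp (hX.measurable j)).sub_const _
    refine ⟨fun n => (hmeas n).aemeasurable, aemeasurable_id, ?_⟩
    refine ProbabilityMeasure.tendsto_of_tendsto_charFun (E := EuclideanSpace ℝ (Fin k))
      fun u => ?_
    have e1 : charFun ((multivariateGaussian 0 S).map id) u =
        Complex.exp (-((1 / 2 * ∑ i, ∑ j, u i * u j * (b i j + 2 * d i j) *
          min (t i) (t j) : ℝ) : ℂ)) := by
      rw [Measure.map_id, charFun_multivariateGaussian hpsd, ← hquad]
      congr 1
      simp
      ring
    simp only [ProbabilityMeasure.coe_mk]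
    rw [e1]
    refine (hlim u).congr fun n => ?_
    rw [charFun_apply, integral_map (hmeas n).aemeasurable
      (by fun_prop : Continuous _).aestronglyMeasurable]
    rfl
  · obtain ⟨φ, hφ⟩ := (hs i).2
    obtain ⟨ψ, hψ⟩ := (hs j).2
    have := hms.symm
    have hT (j : Fin k) (φ : 𝓑) (hφ : ι φ = fun x => (f j x : ℂ)) : R j e = T φ := by
      apply hι.injective
      rw [(hR j e).2, (hS.represents φ).2, hφ, hS.map_one]
      simp only [one_mul, mul_one]
    have h1 : HasSum (fun l : ℕ => cov[fun ω => f i (X 0 ω), fun ω => f j (X (l + 1) ω); μ])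
        (d i j) := by
      have := hX.hasSum_covariance hν hS (s := s) hm (hf_meas i) (hf_sq i) (hs i).1 (hf_meas j)
        (hf_sq j) (hR i) hψ
      rwa [← hT j ψ hψ] at this
    have h2 : HasSum (fun l : ℕ => cov[fun ω => f j (X 0 ω), fun ω => f i (X (l + 1) ω); μ])
        (d j i) := by
      have := hX.hasSum_covariance hν hS (s := s) hm (hf_meas j) (hf_sq j) (hs j).1 (hf_meas i)
        (hf_sq i) (hR j) hφ
      rwa [← hT i φ hφ] at this
    have h3 := hX.covariance_zero hν (hf_meas i) (hf_sq i) (hf_meas j) (hf_sq j)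
    have h4 : Summable (fun l : ℕ => cov[fun ω => f i (X 0 ω), fun ω => f j (X l ω); μ]) :=
      (summable_nat_add_iff 1).1 h1.summable
    refine ⟨h4, h2.summable, ?_⟩
    -- Only the first series contains lag 0, whose term is `b i j`; the positive lags give `d i j`
    -- and `d j i`.
    rw [h4.tsum_eq_zero_add, h1.tsum_eq, h2.tsum_eq, h3]
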